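/- Let $0<H<1$, let $\psi:\mathbb R\to\mathbb R$ be a wavelet (integrable, not a.e. zero, $\int\psi=0$, $\int|t|^H|\psi(t)|\,dt<\infty$), and let $\psi_{jk}(t)=2^{j/2}\psi(2^j(t-k))$, $j,k\in\mathbb Z$, be its non-decimated atoms. A fractional Brownian motion (fBm) with Hurst exponent $H$ and scale $v>0$ is a centred Gaussian process $(B(t))_{t\in\mathbb R}$ with continuous paths and covariance $\frac v2(|s|^{2H}+|t|^{2H}-|t-s|^{2H})$; its coefficient at level $j$ and position $k$ is $d_{jk}=\int_{\mathbb R}B(t)\psi_{jk}(t)\,dt$. Fix a level $j$ and a sample size $N\ge 1$. Sample $N$ pairs $(d_{i,1},d_{i,2})$, $i=1,\dots,N$, of level-$j$ coefficients of fBm's with the same $H$ and $v$ (possibly all of the same fBm), each at an integer position that is deterministic, or random and independent of the fBm whose coefficient is taken. Assume that the $2N$ coefficients $d_{i,1},d_{i,2}$ are independent. Let $\hat y_j^*$ be the sample median of $\log\big[(d_{i,1}^2+d_{i,2}^2)/2\big]$, $i=1,\dots,N$ (the mean of the two middle values if $N$ is even). Then $\hat y_j^*$ is square integrable, and $\operatorname{Var}(\hat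 y_j^*)=V(N)$, where the function $V$ depends on the sample size only (not on the level $j$, nor on $H$, $v$, $\psi$, or the positions), and $$V(N)\sim\frac{1}{N(\log 2)^2}\qquad(N\to\infty),$$ where $1/(\log 2)^2\approx 2.08$ (more precisely $|1/(\log 2)^2-2.08|<0.005$). In particular the variance of the sample median is the same at all levels. -/

import Mathlib

open MeasureTheory ProbabilityTheory Filter
open scoped Asymptotics Topology

/-- Two-sided fractional Brownian motion `B = (B t)` with Hurst exponent `H` and scale `v`
(`v` is the variance of `B 1`): a centred Gaussian process with continuous paths and covariance
`(v / 2) (|s|^{2H} + |t|^{2H} - |t - s|^{2H})`. -/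
structure IsFractionalBrownianMotion {Ω : Type*} [MeasurableSpace Ω] (H v : ℝ)
    (B : ℝ → Ω → ℝ) (P : Measure Ω) : Prop where
  measurable : ∀ t, Measurable (B t)
  isGaussianProcess : IsGaussianProcess B P
  mean_eq_zero : ∀ t, ∫ ω, B t ω ∂P = 0
  covariance_eq : ∀ s t, covariance (B s) (B t) P
    = v / 2 * (|s| ^ (2 * H) + |t| ^ (2 * H) - |t - s| ^ (2 * H))
  continuous_paths : ∀ ω, Continuous fun t => B t ω

/-- What is needed of a wavelet to analyse a fractional Brownian motion with Hurst exponent `H`: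
it is integrable, not almost everywhere zero, has zero mean (one vanishing moment), and decays
fast enough to be integrated against the paths (which grow in mean like `|t| ^ H`). No
orthogonality or compact support is required. -/
structure IsAnalysingWavelet (H : ℝ) (ψ : ℝ → ℝ) : Prop where
  integrable : Integrable ψ
  integrable_rpow_mul : Integrable fun t => |t| ^ H * ψ t
  integral_eq_zero : ∫ t, ψ t = 0
  ne_zero : ¬ (ψ =ᵐ[volume] 0)

/-- The non-decimated wavelet atom `ψ_{jk}(x) = 2^{j/2} ψ(2^j (x - k))`. -/
noncomputable def ndwtAtom (ψ : ℝ → ℝ) (j k : ℤ) (x : ℝ) : ℝ :=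
  (2 : ℝ) ^ ((j : ℝ) / 2) * ψ ((2 : ℝ) ^ j * (x - k))

/-- The non-decimated wavelet coefficient `d_{jk} = ∫ f(t) ψ_{jk}(t) dt` of a signal `f`. -/
noncomputable def ndwtCoeff (ψ f : ℝ → ℝ) (j k : ℤ) : ℝ :=
  ∫ t, f t * ndwtAtom ψ j k t

/-- The logarithm of the average of two energies (squared coefficients). -/
noncomputable def logAveragedEnergy (d₁ d₂ : ℝ) : ℝ :=
  Real.log ((d₁ ^ 2 + d₂ ^ 2) / 2)

/-- The order statistics: `orderStatistic x k` is the `k`-th smallest value, counted from `0`. -/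
noncomputable def orderStatistic {N : ℕ} (x : Fin N → ℝ) (k : Fin N) : ℝ :=
  x (Tuple.sort x k)

/-- The sample median: the middle value if `N` is odd (then the two positions below coincide),
the mean of the two middle values if `N` is even. -/
noncomputable def sampleMedian {N : ℕ} [NeZero N] (x : Fin N → ℝ) : ℝ :=
  (orderStatistic x ⟨(N - 1) / 2, by have := NeZero.pos N; omega⟩
    + orderStatistic x ⟨N / 2, by have := NeZero.pos N; omega⟩) / 2

/-- The MEDLA statistic at level `j`: the sample median of the `N` log-averaged energies. The
`i`-th pair consists of the level-`j` coefficients of the paths `B (i, 0)`, `B (i, 1)` at the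
sampled positions `K (i, 0)`, `K (i, 1)`. -/
noncomputable def medlaMedian {Ω : Type*} {N : ℕ} [NeZero N] (ψ : ℝ → ℝ) (j : ℤ)
    (B : Fin N × Fin 2 → ℝ → Ω → ℝ) (K : Fin N × Fin 2 → Ω → ℤ) (ω : Ω) : ℝ :=
  sampleMedian fun i : Fin N => logAveragedEnergy
    (ndwtCoeff ψ (fun t => B (i, 0) t ω) j (K (i, 0) ω))
    (ndwtCoeff ψ (fun t => B (i, 1) t ω) j (K (i, 1) ω))

/-! A level-`j` coefficient is a mean-square integral of a centred Gaussian process, hence Gaussian.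
Since the atom has zero mean, its variance is the integral of the squared modulus of its Fourier
transform against `ξ ^ (-1 - 2 * H)`, up to a constant. A translation only changes the phase of that
transform, so the variance `w` is the same at all positions, and independent random positions change
nothing. It is positive because an integrable function with vanishing Fourier transform is zero
(`map_ndwtCoeff_random`, `coeffVariance_pos`).

For two independent `N(0, w)` variables, `(d₁² + d₂²) / 2` is `w` times a standard exponential
variable. In Box-Muller form, `1 - exp (-(d₁² + d₂²) / (2 w))` is uniform on `(0, 1)`
(`map_gaussianPairToUniform`). Thus the log-energy is `log w + Q(U)` with `U` uniform and `Q(u) =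
log (-log (1 - u))`. Everything specific to the level, the process and the wavelet sits in the shift
`log w`, which moves the median and leaves its variance alone.

There remains the median of `N` copies of `Q(U)`. As `Q` is increasing, it is the average of `Q`
over the two middle uniform order statistics, which follow beta laws. The upper one has variance
asymptotic to `1 / (4 N)`, and `Q'(1/2) = 2 / log 2`, so linearisation at `1/2` predicts `(2 / log
2)² / (4 N) = 1 / (N (log 2)²)`. The linearisation error has variance `o(1 / N)`: the remainder of
`Q` is at most a multiple of `(u - 1/2)² / (u (1 - u))`, whose square has explicit beta moments of
order `N⁻²`, and the two middle values are close (`variance_linearization_error_le`). The triangle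
inequality for standard deviations then gives the limit (`tendsto_mul_medianVariance`). -/

/-! ### Order statistics and the sample median -/

section OrderStatistics

variable {N : ℕ}

/-- Values at most `a` occupy an initial segment of the sorted sample, and sorting does not change
their number. Counting thus replaces sorting, both for measurability and for the law of an order
statistic. -/
theorem orderStatistic_le_iff (x : Fin N → ℝ) (k : Fin N) (a : ℝ) :
    orderStatistic x k ≤ a ↔ (k : ℕ) < (Finset.univ.filter fun i => x i ≤ a).card := by
  rw [show orderStatistic x k = (x ∘ Tuple.sort x) k from rfl,
    ← Tuple.lt_card_le_iff_apply_le_of_monotone (Tuple.monotone_sort x)]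
  have : (Finset.univ.filter fun i => (x ∘ Tuple.sort x) i ≤ a).card
      = (Finset.univ.filter fun i => x i ≤ a).card := by
    apply Finset.card_bij (fun i _ => Tuple.sort x i)
    · intro i hi; simpa using hi
    · intro i _ j _ h; exact (Tuple.sort x).injective h
    · intro j hj
      exact ⟨(Tuple.sort x).symm j, by simpa using hj, by simp⟩
  rw [this]

theorem orderStatistic_mono (x : Fin N → ℝ) : Monotone (orderStatistic x) :=
  Tuple.monotone_sort x

theorem measurable_orderStatistic (k : Fin N) :
    Measurable fun x : Fin N → ℝ => orderStatistic x k := by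
  refine measurable_of_Iic fun a => ?_
  have : (fun x : Fin N → ℝ => orderStatistic x k) ⁻¹' Set.Iic a
      = {x | (k : ℕ) < ∑ i, if x i ≤ a then 1 else 0} := by
    ext x
    simp only [Set.mem_preimage, Set.mem_Iic, Set.mem_ofPred_eq]
    rw [orderStatistic_le_iff, Finset.card_filter]
  rw [this]
  refine measurableSet_lt measurable_const (Finset.measurable_sum _ fun i _ => ?_)
  exact Measurable.ite (measurableSet_le (measurable_pi_apply i) measurable_const)
    measurable_const measurable_const

theorem measurable_sampleMedian [NeZero N] :
    Measurable fun x : Fin N → ℝ => sampleMedian x :=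
  ((measurable_orderStatistic _).add (measurable_orderStatistic _)).div_const 2

/-- A permutation that sorts `x` also sorts its image under a monotone map. Monotonicity on `s` is
enough, which matters because the quantile function is monotone only on `(0, 1)`. -/
theorem orderStatistic_comp {h : ℝ → ℝ} {s : Set ℝ} (hh : MonotoneOn h s) {x : Fin N → ℝ}
    (hx : ∀ i, x i ∈ s) (k : Fin N) :
    orderStatistic (fun i => h (x i)) k = h (orderStatistic x k) := by
  have h1 : Monotone ((fun i => h (x i)) ∘ Tuple.sort x) := fun i j hij =>
    hh (hx _) (hx _) (Tuple.monotone_sort x hij)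
  exact (congrFun (Tuple.comp_sort_eq_comp_iff_monotone.2 h1) k).symm

theorem sampleMedian_comp [NeZero N] {h : ℝ → ℝ} {s : Set ℝ} (hh : MonotoneOn h s)
    {x : Fin N → ℝ} (hx : ∀ i, x i ∈ s) :
    sampleMedian (fun i => h (x i))
      = (h (orderStatistic x ⟨(N - 1) / 2, by have := NeZero.pos N; omega⟩)
        + h (orderStatistic x ⟨N / 2, by have := NeZero.pos N; omega⟩)) / 2 := by
  simp only [sampleMedian, orderStatistic_comp hh hx]

theorem sampleMedian_const_add [NeZero N] (c : ℝ) (x : Fin N → ℝ) :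
    sampleMedian (fun i => c + x i) = c + sampleMedian x := by
  rw [sampleMedian_comp (h := fun y => c + y) (s := Set.univ)
    (fun a _ b _ hab => by simpa using hab) (fun i => Set.mem_univ (x i))]
  simp only [sampleMedian]
  ring

theorem abs_orderStatistic_le (x : Fin N → ℝ) (k : Fin N) :
    |orderStatistic x k| ≤ ∑ i, |x i| :=
  Finset.single_le_sum (f := fun i => |x i|) (fun _ _ => abs_nonneg _)
    (Finset.mem_univ (Tuple.sort x k))

/-- A crude domination which transfers square integrability from the sample to its median. -/
theorem abs_sampleMedian_le [NeZero N] (x : Fin N → ℝ) : |sampleMedian x| ≤ ∑ i, |x i| := by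
  have h1 := abs_le.1 (abs_orderStatistic_le x ⟨(N - 1) / 2, by have := NeZero.pos N; omega⟩)
  have h2 := abs_le.1 (abs_orderStatistic_le x ⟨N / 2, by have := NeZero.pos N; omega⟩)
  rw [sampleMedian, abs_le]
  constructor <;> linarith [h1.1, h1.2, h2.1, h2.2]

end OrderStatistics

/-! ### Binomial counts and the derivative of their distribution function -/

section Binomial

/-- The probability that a binomial `(N, x)` variable is at most `k`. -/
noncomputable def binomialTail (N k : ℕ) (x : ℝ) : ℝ :=
  ∑ l ∈ Finset.range (k + 1), (N.choose l : ℝ) * (x ^ l * (1 - x) ^ (N - l))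

/-- The event splits according to the set `S` of coordinates that fall in `A`. Each piece is a box,
whose product measure depends on the cardinality of `S` only. -/
theorem measure_pi_card_le {N : ℕ} (μ : Measure ℝ) [IsProbabilityMeasure μ] {A : Set ℝ}
    (hA : MeasurableSet A) [DecidablePred (· ∈ A)] {k : ℕ} (hk : k < N) :
    (Measure.pi fun _ : Fin N => μ).real
      {x | (Finset.univ.filter fun i => x i ∈ A).card ≤ k} = binomialTail N k (μ.real A) := by
  classical
  have hset : {x : Fin N → ℝ | (Finset.univ.filter fun i => x i ∈ A).card ≤ k}
      = ⋃ S ∈ Finset.univ.filter (fun S : Finset (Fin N) => S.card ≤ k),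
        Set.univ.pi fun i => if i ∈ S then A else Aᶜ := by
    ext x
    simp only [Set.mem_ofPred_eq, Finset.mem_filter, Finset.mem_univ, true_and, Set.mem_iUnion,
      Set.mem_univ_pi, exists_prop]
    constructor
    · intro h
      refine ⟨_, h, fun i => ?_⟩
      by_cases hi : x i ∈ A <;> simp [hi]
    · rintro ⟨S, hS, h⟩
      have : (Finset.univ.filter fun i => x i ∈ A) = S := by
        ext i
        have := h i
        by_cases hi : i ∈ S <;> simp_all
      rwa [this]
  rw [hset, measureReal_biUnion_finset]
  · have h1 : ∀ S : Finset (Fin N), (Measure.pi fun _ : Fin N => μ).real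
        (Set.univ.pi fun i => if i ∈ S then A else Aᶜ)
        = μ.real A ^ S.card * (1 - μ.real A) ^ (N - S.card) := by
      intro S
      rw [measureReal_def, Measure.pi_pi, ENNReal.toReal_prod]
      have : ∀ i, (μ (if i ∈ S then A else Aᶜ)).toReal
          = if i ∈ S then μ.real A else 1 - μ.real A := by
        intro i
        split_ifs
        · rfl
        · rw [← probReal_compl_eq_one_sub hA]; rfl
      simp_rw [this]
      rw [Finset.prod_ite, Finset.prod_const, Finset.prod_const]
      congr 2
      · simp
      · rw [Finset.filter_not, Finset.card_sdiff]; simp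
    simp_rw [h1]
    rw [Finset.sum_filter]
    -- Subsets are grouped by cardinality, which produces the binomial coefficients; the condition
    -- `l ≤ k` is carried inside the summand.
    have h2 := Finset.sum_powerset_apply_card
      (f := fun l => if l ≤ k then μ.real A ^ l * (1 - μ.real A) ^ (N - l) else 0)
      (x := (Finset.univ : Finset (Fin N)))
    rw [Finset.powerset_univ] at h2
    rw [h2, binomialTail]
    simp only [Finset.card_univ, Fintype.card_fin, nsmul_eq_mul]
    symm
    apply Finset.sum_subset_zero_on_sdiff
    · intro i; simp only [Finset.mem_range]; omega
    · intro i hi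
      simp only [Finset.mem_sdiff, Finset.mem_range] at hi
      rw [if_neg (by omega), mul_zero]
    · intro i hi
      simp only [Finset.mem_range] at hi
      rw [if_pos (by omega)]
  · intro S _ T _ hST
    rw [Function.onFun, Set.disjoint_left]
    intro x hx hy
    apply hST
    ext i
    have h1 := hx i (Set.mem_univ _)
    have h2 := hy i (Set.mem_univ _)
    by_cases hi : i ∈ S <;> by_cases hj : i ∈ T <;> simp_all
  · intro S _
    refine MeasurableSet.univ_pi fun i => ?_
    split_ifs
    · exact hA
    · exact hA.compl

/-- The derivative telescopes: by `(N - k) C(N, k) = (k + 1) C(N, k + 1)`, half of the derivative of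
each new term cancels the derivative accumulated so far, leaving one monomial. -/
theorem hasDerivAt_binomialTail (N k : ℕ) (hk : k < N) (x : ℝ) :
    HasDerivAt (binomialTail N k)
      (-((N - k : ℕ) * (N.choose k : ℝ) * (x ^ k * (1 - x) ^ (N - 1 - k)))) x := by
  have hb : ∀ m n : ℕ, HasDerivAt (fun x : ℝ => (1 - x) ^ m) (m * (1 - x) ^ (m - 1) * (-1)) x := by
    intro m _
    exact (((hasDerivAt_id x).const_sub 1).pow m)
  induction k with
  | zero =>
    have h1 : binomialTail N 0 = fun x => (1 - x) ^ N := by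
      funext x; simp [binomialTail]
    rw [h1]
    convert hb N 0 using 1
    simp
  | succ k ih =>
    have h1 : binomialTail N (k + 1) = fun x => binomialTail N k x
        + (N.choose (k + 1) : ℝ) * (x ^ (k + 1) * (1 - x) ^ (N - (k + 1))) := by
      funext x; rw [binomialTail, Finset.sum_range_succ]; rfl
    rw [h1]
    have h2 := (ih (by omega)).add
      ((((hasDerivAt_id x).pow (k + 1)).mul (hb (N - (k + 1)) 0)).const_mul (N.choose (k + 1) : ℝ))
    refine h2.congr_deriv ?_
    have h3 : ((N - k : ℕ) : ℝ) * (N.choose k : ℝ) = (k + 1 : ℕ) * (N.choose (k + 1) : ℝ) := by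
      have := Nat.choose_succ_right_eq N k
      rw [mul_comm, mul_comm ((k + 1 : ℕ) : ℝ)]
      exact_mod_cast this.symm
    have h4 : N - 1 - k = N - (k + 1) := by omega
    have h5 : N - 1 - (k + 1) = N - (k + 1) - 1 := by omega
    rw [h3, h4, h5]
    simp only [id, Nat.add_sub_cancel, Pi.pow_apply]
    ring

end Binomial

/-! ### The law of uniform order statistics -/

section Uniform

/-- The uniform distribution on the unit interval. -/
noncomputable def unitUniform : Measure ℝ := volume.restrict (Set.Ioo 0 1)

instance isProbabilityMeasure_unitUniform : IsProbabilityMeasure unitUniform :=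
  ⟨by simp [unitUniform]⟩

theorem ae_mem_unitUniform : ∀ᵐ x ∂unitUniform, x ∈ Set.Ioo (0 : ℝ) 1 :=
  ae_restrict_mem measurableSet_Ioo

/-- Clamping `a` to `[0, 1]` treats all real `a` at once; the two sets can differ only at the
endpoint `1`. -/
theorem unitUniform_Iic_inter (a : ℝ) :
    (Set.Iic a ∩ Set.Ioo 0 1 : Set ℝ) =ᵐ[volume] Set.Ioc 0 (max 0 (min a 1)) := by
  have h : Set.Iic a ∩ Set.Ioo 0 1 = Set.Ioc 0 (max 0 (min a 1)) \ {(1 : ℝ)} := by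
    ext x
    simp only [Set.mem_inter_iff, Set.mem_Iic, Set.mem_Ioo, Set.mem_sdiff, Set.mem_Ioc, le_max_iff,
      le_min_iff, Set.mem_singleton_iff]
    constructor
    · rintro ⟨h1, h2, h3⟩
      exact ⟨⟨h2, Or.inr ⟨h1, h3.le⟩⟩, h3.ne⟩
    · rintro ⟨⟨h1, h2 | h2⟩, h3⟩
      · linarith
      · exact ⟨h2.1, h1, lt_of_le_of_ne h2.2 h3⟩
  rw [h]
  exact sdiff_null_ae_eq_self (by simp)

theorem unitUniform_real_Iic (a : ℝ) : unitUniform.real (Set.Iic a) = max 0 (min a 1) := by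
  rw [unitUniform, measureReal_restrict_apply measurableSet_Iic,
    measureReal_congr (unitUniform_Iic_inter a)]
  simp

/-- The density of the `k`-th order statistic of `N` uniform variables. -/
noncomputable def orderStatisticDensity (N k : ℕ) (x : ℝ) : ℝ :=
  (N - k : ℕ) * (N.choose k : ℝ) * (x ^ k * (1 - x) ^ (N - 1 - k))

theorem continuous_orderStatisticDensity (N k : ℕ) : Continuous (orderStatisticDensity N k) := by
  unfold orderStatisticDensity; fun_prop

theorem orderStatisticDensity_nonneg (N k : ℕ) {x : ℝ} (hx : x ∈ Set.Icc (0 : ℝ) 1) :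
    0 ≤ orderStatisticDensity N k x := by
  have := sub_nonneg.2 hx.2
  have := hx.1
  unfold orderStatisticDensity; positivity

theorem integral_orderStatisticDensity_Ioc {N k : ℕ} (hk : k < N) {a : ℝ} (ha : 0 ≤ a) :
    ∫ x in Set.Ioc 0 a, orderStatisticDensity N k x = 1 - binomialTail N k a := by
  rw [← intervalIntegral.integral_of_le ha]
  have h := intervalIntegral.integral_eq_sub_of_hasDerivAt (a := 0) (b := a)
    (f := fun x => - binomialTail N k x) (f' := orderStatisticDensity N k)
    (fun x _ => by
      have := (hasDerivAt_binomialTail N k hk x).neg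
      rw [neg_neg] at this; exact this)
    ((continuous_orderStatisticDensity N k).intervalIntegrable _ _)
  rw [h]
  have h0 : binomialTail N k 0 = 1 := by
    rw [binomialTail, Finset.sum_range_succ']
    simp
  rw [h0]; ring

/-- The distribution functions agree. The order statistic exceeds `a` exactly when at most `k`
coordinates are `≤ a`, a binomial event, and the density is minus the derivative of that binomial
probability. -/
theorem map_orderStatistic_pi {N : ℕ} (k : Fin N) :
    (Measure.pi fun _ : Fin N => unitUniform).map (fun x => orderStatistic x k)
      = unitUniform.withDensity fun x => ENNReal.ofReal (orderStatisticDensity N k x) := by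
  classical
  have : IsProbabilityMeasure ((Measure.pi fun _ : Fin N => unitUniform).map
    (fun x => orderStatistic x k)) :=
    Measure.isProbabilityMeasure_map (measurable_orderStatistic k).aemeasurable
  refine Measure.ext_of_Iic _ _ fun a => ?_
  have hc0 : 0 ≤ max 0 (min a 1) := le_max_left _ _
  have hc1 : max 0 (min a 1) ≤ 1 := max_le zero_le_one (min_le_right _ _)
  have hL : ((Measure.pi fun _ : Fin N => unitUniform).map (fun x => orderStatistic x k)).real
      (Set.Iic a) = 1 - binomialTail N k (max 0 (min a 1)) := by
    rw [map_measureReal_apply (measurable_orderStatistic k) measurableSet_Iic]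
    have h1 : (fun x : Fin N → ℝ => orderStatistic x k) ⁻¹' Set.Iic a
        = {x | (Finset.univ.filter fun i => x i ∈ Set.Iic a).card ≤ k}ᶜ := by
      ext x
      simp only [Set.mem_preimage, Set.mem_Iic, Set.mem_compl_iff, Set.mem_ofPred_eq, not_le]
      exact orderStatistic_le_iff x k a
    have hm : MeasurableSet {x : Fin N → ℝ |
        (Finset.univ.filter fun i => x i ∈ Set.Iic a).card ≤ k} := by
      rw [← MeasurableSet.compl_iff, ← h1]
      exact measurable_orderStatistic k measurableSet_Iic
    rw [h1, probReal_compl_eq_one_sub hm, measure_pi_card_le _ measurableSet_Iic k.2,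
      unitUniform_real_Iic]
  have hR : (unitUniform.withDensity fun x => ENNReal.ofReal (orderStatisticDensity N k x))
      (Set.Iic a) = ENNReal.ofReal (1 - binomialTail N k (max 0 (min a 1))) := by
    rw [withDensity_apply _ measurableSet_Iic, unitUniform,
      Measure.restrict_restrict measurableSet_Iic,
      Measure.restrict_congr_set (unitUniform_Iic_inter a),
      ← integral_orderStatisticDensity_Ioc k.2 hc0, ofReal_integral_eq_lintegral_ofReal]
    · exact ((continuous_orderStatisticDensity N k).integrableOn_Icc).mono_set
        Set.Ioc_subset_Icc_self
    · filter_upwards [ae_restrict_mem measurableSet_Ioc] with x hx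
      exact orderStatisticDensity_nonneg N k ⟨hx.1.le, hx.2.trans hc1⟩
  rw [hR, ← hL, ofReal_measureReal]

theorem integral_orderStatistic_pi {N : ℕ} (k : Fin N) {f : ℝ → ℝ} (hf : Measurable f) :
    ∫ x, f (orderStatistic x k) ∂(Measure.pi fun _ : Fin N => unitUniform)
      = ∫ x in Set.Ioo 0 1, orderStatisticDensity N k x * f x := by
  have h1 := integral_map (μ := Measure.pi fun _ : Fin N => unitUniform)
    (measurable_orderStatistic k).aemeasurable (f := f) hf.aestronglyMeasurable
  rw [← h1, map_orderStatistic_pi, integral_withDensity_eq_integral_toReal_smul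
    (continuous_orderStatisticDensity N k).measurable.ennreal_ofReal
    (Eventually.of_forall fun x => ENNReal.ofReal_lt_top)]
  refine setIntegral_congr_fun measurableSet_Ioo fun x hx => ?_
  simp only [smul_eq_mul]
  rw [ENNReal.toReal_ofReal (orderStatisticDensity_nonneg N k ⟨hx.1.le, hx.2.le⟩)]

theorem integrable_orderStatistic_pi_iff {N : ℕ} (k : Fin N) {f : ℝ → ℝ} (hf : Measurable f) :
    Integrable (fun x => f (orderStatistic x k)) (Measure.pi fun _ : Fin N => unitUniform)
      ↔ IntegrableOn (fun x => orderStatisticDensity N k x * f x) (Set.Ioo 0 1) := by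
  have h1 := integrable_map_measure (μ := Measure.pi fun _ : Fin N => unitUniform) (g := f)
    hf.aestronglyMeasurable (measurable_orderStatistic k).aemeasurable
  rw [show (fun x => f (orderStatistic x k)) = f ∘ (fun x : Fin N → ℝ => orderStatistic x k)
    from rfl, ← h1, map_orderStatistic_pi, integrable_withDensity_iff_integrable_smul'
    (continuous_orderStatisticDensity N k).measurable.ennreal_ofReal
    (Eventually.of_forall fun x => ENNReal.ofReal_lt_top)]
  refine integrable_congr ?_
  filter_upwards [ae_mem_unitUniform] with x hx
  simp only [smul_eq_mul]
  rw [ENNReal.toReal_ofReal (orderStatisticDensity_nonneg N k ⟨hx.1.le, hx.2.le⟩)]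

end Uniform

/-! ### The quantile function of the log-exponential law and its linearisation -/

section LogLog

/-- The quantile function of the logarithm of a standard exponential variable. -/
noncomputable def logExpQuantile (u : ℝ) : ℝ := Real.log (-Real.log (1 - u))

theorem measurable_logExpQuantile : Measurable logExpQuantile := by
  unfold logExpQuantile; fun_prop

theorem le_neg_log_one_sub {u : ℝ} (hu : u < 1) : u ≤ -Real.log (1 - u) := by
  have := Real.log_le_sub_one_of_pos (sub_pos.2 hu); linarith

theorem monotoneOn_logExpQuantile : MonotoneOn logExpQuantile (Set.Ioo 0 1) := by
  intro a ha b hb hab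
  refine Real.log_le_log (lt_of_lt_of_le ha.1 (le_neg_log_one_sub ha.2)) ?_
  exact neg_le_neg (Real.log_le_log (sub_pos.2 hb.2) (by linarith))

/-- With `x = y²` the claim is `|y log y| ≤ |y² - 1|`, which follows from `1 - 1/y ≤ log y ≤ y - 1`.
Passing to the square root yields a single power of `x` in the denominator. -/
theorem sq_log_le {x : ℝ} (hx : 0 < x) : Real.log x ^ 2 ≤ 4 * (x - 1) ^ 2 / x := by
  obtain ⟨y, hy, rfl⟩ : ∃ y : ℝ, 0 < y ∧ x = y ^ 2 :=
    ⟨√x, Real.sqrt_pos.2 hx, (Real.sq_sqrt hx.le).symm⟩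
  rw [Real.log_pow, le_div_iff₀ hx]
  have h1 := Real.log_le_sub_one_of_pos hy
  have h2 := Real.one_sub_inv_le_log_of_pos hy
  have h3 : (Real.log y * y) ^ 2 ≤ ((y - 1) * (y + 1)) ^ 2 := by
    rcases le_total 1 y with h | h
    · have := mul_nonneg (Real.log_nonneg h) hy.le
      apply sq_le_sq' <;> nlinarith
    · have h4 : y - 1 ≤ Real.log y * y := by
        have := mul_le_mul_of_nonneg_right h2 hy.le
        rw [sub_mul, inv_mul_cancel₀ hy.ne'] at this; linarith
      have h5 := mul_nonneg (neg_nonneg.2 (Real.log_nonpos hy.le h)) hy.le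
      rw [← neg_sq ((y - 1) * (y + 1))]
      apply sq_le_sq' <;> nlinarith
  push_cast
  nlinarith [h3]

/-- The error of the first order Taylor expansion of `logExpQuantile` at `1 / 2`. -/
noncomputable def quantileRemainder (u : ℝ) : ℝ :=
  logExpQuantile u - logExpQuantile (1 / 2) - 2 / Real.log 2 * (u - 1 / 2)

/-- The weighted fourth power which controls `quantileRemainder`. -/
noncomputable def quarticWeight (u : ℝ) : ℝ := ((u - 1 / 2) ^ 2 / (u * (1 - u))) ^ 2

theorem measurable_quarticWeight : Measurable quarticWeight := by
  unfold quarticWeight; fun_prop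

/-- The bound must hold on all of `(0, 1)`, with controlled blow-up at both ends, so Taylor's
formula is replaced by `1 - 1/x ≤ log x ≤ x - 1`. This is applied to the inner logarithm at `1 / (2
(1 - u))` and to the outer one at `L / log 2`, where `L = -log (1 - u)`. -/
theorem abs_quantileRemainder_le {u : ℝ} (hu : u ∈ Set.Ioo (0 : ℝ) 1) :
    |quantileRemainder u| ≤ 8 / Real.log 2 * ((u - 1 / 2) ^ 2 / (u * (1 - u))) := by
  obtain ⟨h0, h1⟩ := hu
  have hv : 0 < 1 - u := sub_pos.2 h1
  have hl : 0 < Real.log 2 := Real.log_pos (by norm_num)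
  have hL : u ≤ -Real.log (1 - u) := le_neg_log_one_sub h1
  set L := -Real.log (1 - u) with hLdef
  have hL0 : 0 < L := h0.trans_le hL
  have hx : 0 < 1 / (2 * (1 - u)) := by positivity
  have hdiff : Real.log (1 / (2 * (1 - u))) = L - Real.log 2 := by
    rw [one_div, Real.log_inv, Real.log_mul (by norm_num) hv.ne', hLdef]; ring
  have hq : logExpQuantile u - logExpQuantile (1 / 2) = Real.log (L / Real.log 2) := by
    rw [Real.log_div hL0.ne' hl.ne']
    simp only [logExpQuantile]
    rw [show (1 : ℝ) - 1 / 2 = 2⁻¹ by norm_num, Real.log_inv, neg_neg]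
  have hsq := sq_log_le hx
  have hup := Real.log_le_sub_one_of_pos hx
  have hlo : 2 * (u - 1 / 2) ≤ L - Real.log 2 := by
    have := Real.one_sub_inv_le_log_of_pos hx
    rw [hdiff] at this
    have h2 : (1 / (2 * (1 - u)))⁻¹ = 2 * (1 - u) := by rw [one_div, inv_inv]
    rw [h2] at this; linarith
  rw [hdiff] at hsq hup
  have hx1 : 1 / (2 * (1 - u)) - 1 = (u - 1 / 2) / (1 - u) := by field_simp; ring
  have hup' : L - Real.log 2 ≤ (u - 1 / 2) / (1 - u) := by rw [← hx1]; exact hup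
  have hsq' : (L - Real.log 2) ^ 2 ≤ 8 * (u - 1 / 2) ^ 2 / (1 - u) := by
    refine hsq.trans (le_of_eq ?_)
    rw [hx1]; field_simp; ring
  have hp : 0 < L / Real.log 2 := div_pos hL0 hl
  rw [quantileRemainder, hq, abs_le]
  constructor
  · have h3 := Real.one_sub_inv_le_log_of_pos hp
    -- The lower bound is split into its linear part and a quadratic error; `L ≥ u` and the bound on
    -- `(L - log 2)²` control the error.
    have h4 : 1 - (L / Real.log 2)⁻¹
        = (L - Real.log 2) / Real.log 2 - (L - Real.log 2) ^ 2 / (L * Real.log 2) := by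
      field_simp; ring
    have h5 : (L - Real.log 2) ^ 2 / (L * Real.log 2)
        ≤ 8 / Real.log 2 * ((u - 1 / 2) ^ 2 / (u * (1 - u))) := by
      calc (L - Real.log 2) ^ 2 / (L * Real.log 2)
          ≤ (8 * (u - 1 / 2) ^ 2 / (1 - u)) / (u * Real.log 2) := by
            gcongr
        _ = _ := by field_simp
    have h6 : 2 / Real.log 2 * (u - 1 / 2) ≤ (L - Real.log 2) / Real.log 2 := by
      rw [div_mul_eq_mul_div]; gcongr
    linarith
  · have h3 := Real.log_le_sub_one_of_pos hp
    have h4 : L / Real.log 2 - 1 = (L - Real.log 2) / Real.log 2 := by field_simp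
    have h5 : (L - Real.log 2) / Real.log 2 ≤ ((u - 1 / 2) / (1 - u)) / Real.log 2 := by gcongr
    have h6 : ((u - 1 / 2) / (1 - u)) / Real.log 2 - 2 / Real.log 2 * (u - 1 / 2)
        = 2 / Real.log 2 * ((u - 1 / 2) ^ 2 * u / (u * (1 - u))) := by field_simp; ring
    have h7 : 2 / Real.log 2 * ((u - 1 / 2) ^ 2 * u / (u * (1 - u)))
        ≤ 8 / Real.log 2 * ((u - 1 / 2) ^ 2 / (u * (1 - u))) := by
      have := mul_pos h0 hv
      gcongr
      · norm_num
      · nlinarith [sq_nonneg (u - 1 / 2)]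
    linarith

theorem sq_quantileRemainder_le {u : ℝ} (hu : u ∈ Set.Ioo (0 : ℝ) 1) :
    quantileRemainder u ^ 2 ≤ (8 / Real.log 2) ^ 2 * quarticWeight u := by
  have := abs_quantileRemainder_le hu
  rw [quarticWeight, ← mul_pow, ← sq_abs]
  exact pow_le_pow_left₀ (abs_nonneg _) this 2

theorem pow_four_le_quarticWeight {u : ℝ} (hu : u ∈ Set.Ioo (0 : ℝ) 1) :
    (u - 1 / 2) ^ 4 ≤ quarticWeight u := by
  have h0 := hu.1
  have h1 : 0 < 1 - u := sub_pos.2 hu.2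
  rw [quarticWeight, show (u - 1 / 2) ^ 4 = ((u - 1 / 2) ^ 2) ^ 2 by ring]
  gcongr
  rw [le_div_iff₀ (mul_pos h0 h1)]
  nlinarith [sq_nonneg (u - 1 / 2)]

/-- The singularities at `0` and `1` are logarithmic or weaker, hence dominated by `4 u^(-1/4)` and
`4 (1 - u)^(-1/4)`. The exponent `1/4` is chosen so that the squares, of order `-1/2`, are
integrable. -/
theorem memLp_logExpQuantile : MemLp logExpQuantile 2 unitUniform := by
  have hlog : MemLp (fun u : ℝ => u ^ (-(1 / 4 : ℝ))) 2 unitUniform := by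
    rw [memLp_two_iff_integrable_sq (by fun_prop)]
    have h := (intervalIntegral.intervalIntegrable_rpow' (a := 0) (b := 1)
      (r := -(1 / 2)) (by norm_num)).1
    rw [unitUniform, ← IntegrableOn]
    refine (h.mono_set Set.Ioo_subset_Ioc_self).congr_fun (fun x hx => ?_) measurableSet_Ioo
    simp only []
    rw [← Real.rpow_natCast, ← Real.rpow_mul hx.1.le]
    norm_num
  have hmp : MeasurePreserving (fun u : ℝ => 1 - u) unitUniform unitUniform := by
    have := (Measure.measurePreserving_sub_left volume (1 : ℝ)).restrict_preimage
      (measurableSet_Ioo (a := (0 : ℝ)) (b := 1))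
    simpa [unitUniform] using this
  have hlog' := hlog.comp_measurePreserving hmp
  refine MemLp.mono' ((hlog.const_mul 4).add (hlog'.const_mul 4))
    measurable_logExpQuantile.aestronglyMeasurable ?_
  filter_upwards [ae_mem_unitUniform] with u hu
  have h0 := hu.1
  have h1 : 0 < 1 - u := sub_pos.2 hu.2
  have hL := le_neg_log_one_sub hu.2
  have hL0 := h0.trans_le hL
  have key : ∀ x : ℝ, 0 < x → -Real.log x ≤ 4 * x ^ (-(1 / 4 : ℝ)) := by
    intro x hx
    have := Real.log_le_rpow_div (x := x⁻¹) (ε := 1 / 4) (by positivity) (by norm_num)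
    rw [Real.log_inv, Real.inv_rpow hx.le, ← Real.rpow_neg hx.le] at this
    linarith
  have k1 := key u h0
  have k2 := key (1 - u) h1
  have p1 := Real.rpow_pos_of_pos h0 (-(1 / 4))
  have p2 := Real.rpow_pos_of_pos h1 (-(1 / 4))
  rw [Real.norm_eq_abs, logExpQuantile, abs_le]
  simp only [Pi.add_apply, Function.comp_apply]
  constructor
  · have := Real.log_le_log h0 hL
    linarith
  · have := Real.log_le_sub_one_of_pos hL0
    linarith

end LogLog

/-! ### Moments of the beta laws -/

section BetaMoments

/-- The beta integral with natural exponents. -/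
noncomputable def betaInt (a b : ℕ) : ℝ := ∫ x in Set.Ioo (0 : ℝ) 1, x ^ a * (1 - x) ^ b

theorem integrableOn_pow_mul_pow (a b : ℕ) :
    IntegrableOn (fun x : ℝ => x ^ a * (1 - x) ^ b) (Set.Ioo 0 1) :=
  (Continuous.integrableOn_Icc (by fun_prop)).mono_set Set.Ioo_subset_Icc_self

/-- The order statistic density has total mass one, because the binomial tail vanishes at `1`. This
evaluates the beta integral. -/
theorem betaInt_mul_eq_one (a b : ℕ) :
    ((b + 1 : ℕ) * ((a + b + 1).choose a : ℝ)) * betaInt a b = 1 := by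
  have h := integral_orderStatisticDensity_Ioc (N := a + b + 1) (k := a) (by omega)
    (zero_le_one (α := ℝ))
  have h1 : binomialTail (a + b + 1) a 1 = 0 := by
    rw [binomialTail]
    refine Finset.sum_eq_zero fun l hl => ?_
    rw [Finset.mem_range] at hl
    rw [sub_self, zero_pow (by omega), mul_zero, mul_zero]
  rw [h1, sub_zero, integral_Ioc_eq_integral_Ioo] at h
  rw [betaInt, ← integral_const_mul]
  refine Eq.trans ?_ h
  congr 1
  funext x
  rw [orderStatisticDensity, show a + b + 1 - a = b + 1 by omega,
    show a + b + 1 - 1 - a = b by omega]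

theorem betaInt_eq (a b : ℕ) :
    betaInt a b = (a.factorial * b.factorial : ℝ) / (a + b + 1).factorial := by
  have h := betaInt_mul_eq_one a b
  have h2 : ((b + 1 : ℕ) * ((a + b + 1).choose a : ℝ)) * (a.factorial * b.factorial : ℝ)
      = (a + b + 1).factorial := by
    have := Nat.choose_mul_factorial_mul_factorial (n := a + b + 1) (k := a) (by omega)
    rw [show a + b + 1 - a = b + 1 by omega, Nat.factorial_succ] at this
    rw [← this]; push_cast; ring
  rw [eq_div_iff (by positivity), ← h2]
  linear_combination (a.factorial * b.factorial : ℝ) * h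

theorem betaInt_pos (a b : ℕ) : 0 < betaInt a b := by rw [betaInt_eq]; positivity

theorem betaInt_succ_left (a b : ℕ) :
    betaInt (a + 1) b = (a + 1) / (a + b + 2) * betaInt a b := by
  rw [betaInt_eq, betaInt_eq, show a + 1 + b + 1 = (a + b + 1) + 1 by ring,
    Nat.factorial_succ (a + b + 1), Nat.factorial_succ a]
  have : ((a + b + 1).factorial : ℝ) ≠ 0 := by positivity
  push_cast
  field_simp
  ring

theorem betaInt_succ_right (a b : ℕ) :
    betaInt a (b + 1) = (b + 1) / (a + b + 2) * betaInt a b := by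
  rw [betaInt_eq, betaInt_eq, show a + (b + 1) + 1 = (a + b + 1) + 1 by ring,
    Nat.factorial_succ (a + b + 1), Nat.factorial_succ b]
  have : ((a + b + 1).factorial : ℝ) ≠ 0 := by positivity
  push_cast
  field_simp
  ring

theorem orderStatisticDensity_eq (a b : ℕ) (x : ℝ) :
    orderStatisticDensity (a + b + 1) a x = (betaInt a b)⁻¹ * (x ^ a * (1 - x) ^ b) := by
  have h := betaInt_mul_eq_one a b
  rw [orderStatisticDensity, show a + b + 1 - a = b + 1 by omega,
    show a + b + 1 - 1 - a = b by omega, eq_inv_of_mul_eq_one_left h]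

variable {N : ℕ}

/-- Here `a` positions lie below `k` and `b` above, so the law is Beta`(a + 1, b + 1)`. -/
theorem integral_orderStatistic (k : Fin N) (a b : ℕ) (ha : (k : ℕ) = a) (hb : N = a + b + 1) :
    ∫ x, orderStatistic x k ∂(Measure.pi fun _ : Fin N => unitUniform) = (a + 1) / (a + b + 2) := by
  rw [integral_orderStatistic_pi k (f := fun x => x) measurable_id]
  subst hb
  rw [ha]
  have : ∀ x : ℝ, orderStatisticDensity (a + b + 1) a x * x
      = (betaInt a b)⁻¹ * (x ^ (a + 1) * (1 - x) ^ b) := by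
    intro x; rw [orderStatisticDensity_eq]; ring
  simp_rw [this]
  rw [integral_const_mul, ← betaInt, betaInt_succ_left]
  have := (betaInt_pos a b).ne'
  field_simp

theorem integral_orderStatistic_sub_half_sq (k : Fin N) (a b : ℕ) (ha : (k : ℕ) = a)
    (hb : N = a + b + 1) :
    ∫ x, (orderStatistic x k - 1 / 2) ^ 2 ∂(Measure.pi fun _ : Fin N => unitUniform)
      = (1 / 4 - (a + 1) * (b + 1) / ((a + b + 2) * (a + b + 3)) : ℝ) := by
  rw [integral_orderStatistic_pi k (f := fun x => (x - 1 / 2) ^ 2) (by fun_prop)]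
  subst hb
  rw [ha]
  -- The identity `(x - 1/2)² = 1/4 - x (1 - x)` keeps every term a beta integrand.
  have : ∀ x : ℝ, orderStatisticDensity (a + b + 1) a x * (x - 1 / 2) ^ 2
      = (betaInt a b)⁻¹ * (1 / 4 * (x ^ a * (1 - x) ^ b) - x ^ (a + 1) * (1 - x) ^ (b + 1)) := by
    intro x; rw [orderStatisticDensity_eq]; ring
  simp_rw [this]
  rw [integral_const_mul, integral_sub ((integrableOn_pow_mul_pow a b).const_mul _)
    (integrableOn_pow_mul_pow _ _), integral_const_mul, ← betaInt, ← betaInt, betaInt_succ_left,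
    betaInt_succ_right]
  have := (betaInt_pos a b).ne'
  push_cast
  field_simp
  ring

/-- Again `(x - 1/2)² = 1/4 - x (1 - x)`. The weight divides by `(x (1 - x))²`, so both exponents of
the density must be at least `2`; hence the shifts `a + 2` and `b + 2`. -/
theorem orderStatisticDensity_mul_quarticWeight (a b : ℕ) {x : ℝ} (hx : x ∈ Set.Ioo (0 : ℝ) 1) :
    orderStatisticDensity (a + 2 + (b + 2) + 1) (a + 2) x * quarticWeight x
      = (betaInt (a + 2) (b + 2))⁻¹ * (1 / 16 * (x ^ a * (1 - x) ^ b)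
        - 1 / 2 * (x ^ (a + 1) * (1 - x) ^ (b + 1)) + x ^ (a + 2) * (1 - x) ^ (b + 2)) := by
  have h0 := hx.1.ne'
  have h1 : 1 - x ≠ 0 := (sub_pos.2 hx.2).ne'
  rw [orderStatisticDensity_eq, quarticWeight]
  field_simp
  ring

theorem integrable_quarticWeight_orderStatistic (k : Fin N) (a b : ℕ) (ha : (k : ℕ) = a + 2)
    (hb : N = a + 2 + (b + 2) + 1) :
    Integrable (fun x => quarticWeight (orderStatistic x k))
      (Measure.pi fun _ : Fin N => unitUniform) := by
  rw [integrable_orderStatistic_pi_iff k measurable_quarticWeight]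
  subst hb
  rw [ha]
  refine IntegrableOn.congr_fun ?_
    (fun x hx => (orderStatisticDensity_mul_quarticWeight a b hx).symm) measurableSet_Ioo
  exact ((((integrableOn_pow_mul_pow a b).const_mul _).sub
    ((integrableOn_pow_mul_pow _ _).const_mul _)).add (integrableOn_pow_mul_pow _ _)).const_mul _

theorem integral_quarticWeight_orderStatistic (k : Fin N) (a b : ℕ) (ha : (k : ℕ) = a + 2)
    (hb : N = a + 2 + (b + 2) + 1) :
    ∫ x, quarticWeight (orderStatistic x k) ∂(Measure.pi fun _ : Fin N => unitUniform)
      = 1 / 16 * ((a + b + 2) * (a + b + 3) * (a + b + 4) * (a + b + 5)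
          / ((a + 1) * (a + 2) * (b + 1) * (b + 2)))
        - 1 / 2 * ((a + b + 4) * (a + b + 5) / ((a + 2) * (b + 2))) + 1 := by
  rw [integral_orderStatistic_pi k measurable_quarticWeight]
  subst hb
  rw [ha, setIntegral_congr_fun measurableSet_Ioo
    (fun x hx => orderStatisticDensity_mul_quarticWeight a b hx)]
  have h : IntegrableOn (fun x : ℝ => 1 / 16 * (x ^ a * (1 - x) ^ b)
      - 1 / 2 * (x ^ (a + 1) * (1 - x) ^ (b + 1))) (Set.Ioo 0 1) :=
    ((integrableOn_pow_mul_pow a b).const_mul _).sub ((integrableOn_pow_mul_pow _ _).const_mul _)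
  rw [integral_const_mul, integral_add h (integrableOn_pow_mul_pow _ _),
    integral_sub ((integrableOn_pow_mul_pow a b).const_mul _)
    ((integrableOn_pow_mul_pow _ _).const_mul _), integral_const_mul, integral_const_mul,
    ← betaInt, ← betaInt, ← betaInt, betaInt_succ_left (a + 1) (b + 2),
    betaInt_succ_right (a + 1) (b + 1), betaInt_succ_left a (b + 1), betaInt_succ_right a b]
  have := (betaInt_pos a b).ne'
  push_cast
  field_simp
  ring

end BetaMoments

/-! ### The triangle inequality for standard deviations -/

section StandardDeviation

variable {Ω : Type*} {mΩ : MeasurableSpace Ω} {μ : Measure Ω} [IsProbabilityMeasure μ]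

/-- The variance of `X + t Y` is a nonnegative quadratic polynomial in `t`, so its discriminant is
nonpositive. -/
theorem sq_covariance_le {X Y : Ω → ℝ} (hX : MemLp X 2 μ) (hY : MemLp Y 2 μ) :
    covariance X Y μ ^ 2 ≤ variance X μ * variance Y μ := by
  have h := discrim_le_zero (a := variance Y μ) (b := 2 * covariance X Y μ) (c := variance X μ)
    fun t => by
      have h1 := variance_nonneg (X + t • Y) μ
      rw [variance_add hX (hY.const_smul t), variance_smul, covariance_smul_right] at h1
      linarith
  rw [discrim] at h
  linarith

theorem sqrt_variance_add_le {X Y : Ω → ℝ} (hX : MemLp X 2 μ) (hY : MemLp Y 2 μ) :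
    √(variance (X + Y) μ) ≤ √(variance X μ) + √(variance Y μ) := by
  refine Real.sqrt_le_iff.2 ⟨by positivity, ?_⟩
  rw [variance_add hX hY, add_sq, Real.sq_sqrt (variance_nonneg _ _),
    Real.sq_sqrt (variance_nonneg _ _), mul_assoc, ← Real.sqrt_mul (variance_nonneg _ _)]
  have := Real.le_sqrt_of_sq_le (sq_covariance_le hX hY)
  linarith

/-- This lets a linearisation error of variance `o(1 / N)` be discarded without examining its
correlation with the main term. -/
theorem abs_sqrt_variance_sub_le {X Y : Ω → ℝ} (hX : MemLp X 2 μ) (hY : MemLp Y 2 μ) :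
    |√(variance X μ) - √(variance Y μ)| ≤ √(variance (X - Y) μ) := by
  have h1 := sqrt_variance_add_le hY (hX.sub hY)
  have h2 := sqrt_variance_add_le hX (hY.sub hX)
  rw [add_sub_cancel] at h1 h2
  have h3 : variance (Y - X) μ = variance (X - Y) μ := by
    rw [← neg_sub X Y, show -(X - Y) = (-1 : ℝ) • (X - Y) by simp, variance_smul]; norm_num
  rw [h3] at h2
  rw [abs_le]; constructor <;> linarith

end StandardDeviation

/-! ### The middle order statistics and the linearisation error -/

section MedianIndices

theorem ae_pi_unitUniform_mem (N : ℕ) :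
    ∀ᵐ x ∂(Measure.pi fun _ : Fin N => unitUniform), ∀ i, x i ∈ Set.Ioo (0 : ℝ) 1 := by
  rw [ae_all_iff]
  intro i
  exact (measurePreserving_eval (fun _ : Fin N => unitUniform) i).quasiMeasurePreserving.ae
    ae_mem_unitUniform

theorem ae_orderStatistic_mem (N : ℕ) (k : Fin N) :
    ∀ᵐ x ∂(Measure.pi fun _ : Fin N => unitUniform), orderStatistic x k ∈ Set.Ioo (0 : ℝ) 1 := by
  filter_upwards [ae_pi_unitUniform_mem N] with x hx using hx _

theorem memLp_orderStatistic (N : ℕ) (k : Fin N) :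
    MemLp (fun x => orderStatistic x k) 2 (Measure.pi fun _ : Fin N => unitUniform) := by
  refine MemLp.of_bound (measurable_orderStatistic k).aestronglyMeasurable 1 ?_
  filter_upwards [ae_orderStatistic_mem N k] with x hx
  rw [Real.norm_eq_abs, abs_le]
  constructor <;> linarith [hx.1, hx.2]

variable (N : ℕ) [NeZero N]

/-- The upper middle position of a sample of size `N`. -/
def upperMedianIndex : Fin N := ⟨N / 2, by have := NeZero.pos N; omega⟩

/-- The lower middle position of a sample of size `N`. -/
def lowerMedianIndex : Fin N := ⟨(N - 1) / 2, by have := NeZero.pos N; omega⟩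

theorem memLp_sampleMedian_logExpQuantile :
    MemLp (fun x : Fin N → ℝ => sampleMedian fun i => logExpQuantile (x i)) 2
      (Measure.pi fun _ : Fin N => unitUniform) := by
  have hmeas : Measurable fun x : Fin N → ℝ => fun i => logExpQuantile (x i) :=
    measurable_pi_lambda _ fun i => measurable_logExpQuantile.comp (measurable_pi_apply i)
  refine MemLp.mono' (g := fun x => ∑ i, |logExpQuantile (x i)|) ?_
    (measurable_sampleMedian.comp hmeas).aestronglyMeasurable
    (Eventually.of_forall fun x => abs_sampleMedian_le _)
  refine memLp_finsetSum _ fun i _ => ?_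
  exact (memLp_logExpQuantile.comp_measurePreserving
    (measurePreserving_eval (fun _ : Fin N => unitUniform) i)).abs

variable {N}

/-- Near `1/2` the weight is about `16 (u - 1/2)⁴`, and the variance is about `1 / (4 N)`, so the
true leading term is `3 / N²`. The constant `7` leaves room for a bound valid from `N = 10` on. -/
theorem quarticWeight_upper_lower (hN : 10 ≤ N) (k : Fin N)
    (hk : k = upperMedianIndex N ∨ k = lowerMedianIndex N) :
    Integrable (fun x => quarticWeight (orderStatistic x k))
        (Measure.pi fun _ : Fin N => unitUniform) ∧
      ∫ x, quarticWeight (orderStatistic x k) ∂(Measure.pi fun _ : Fin N => unitUniform)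
        ≤ 7 / (N : ℝ) ^ 2 := by
  -- The three cases are the upper and the lower middle of an even sample, and the middle of an odd
  -- one.
  have hcase : ∃ a b q : ℕ, 2 ≤ q ∧ (k : ℕ) = a + 2 ∧ N = a + 2 + (b + 2) + 1 ∧
      ((a = q + 1 ∧ b = q) ∨ (a = q ∧ b = q + 1) ∨ (a = q ∧ b = q)) := by
    refine ⟨k - 2, N - k - 3, min (k - 2) (N - k - 3), ?_⟩
    rcases hk with rfl | rfl <;> simp only [upperMedianIndex, lowerMedianIndex] <;> omega
  obtain ⟨a, b, q, hq, ha, hb, hab⟩ := hcase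
  refine ⟨integrable_quarticWeight_orderStatistic k a b ha hb, ?_⟩
  rw [integral_quarticWeight_orderStatistic k a b ha hb]
  have hNr : (N : ℝ) = a + b + 5 := by rw [hb]; push_cast; ring
  rw [hNr]
  -- In terms of `r` the expanded inequalities have nonnegative coefficients, so `positivity` closes
  -- them.
  obtain ⟨r, rfl⟩ : ∃ r, q = r + 2 := ⟨q - 2, by omega⟩
  rcases hab with ⟨rfl, rfl⟩ | ⟨rfl, rfl⟩ | ⟨rfl, rfl⟩ <;> push_cast
  all_goals
    rw [← sub_nonneg]
    field_simp
    ring_nf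
    positivity

/-- Neighbouring uniform order statistics are at mean distance `1 / (N + 1)`, and for odd `N` the
two positions coincide. -/
theorem integral_gap_le :
    ∫ x, (orderStatistic x (upperMedianIndex N) - orderStatistic x (lowerMedianIndex N))
      ∂(Measure.pi fun _ : Fin N => unitUniform) ≤ 1 / (N : ℝ) := by
  have hN := NeZero.pos N
  rw [integral_sub ((memLp_orderStatistic N _).integrable one_le_two)
    ((memLp_orderStatistic N _).integrable one_le_two),
    integral_orderStatistic (upperMedianIndex N) (N / 2) (N - 1 - N / 2) rfl (by omega),
    integral_orderStatistic (lowerMedianIndex N) ((N - 1) / 2) (N - 1 - (N - 1) / 2) rfl (by omega)]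
  have h1 : ((N / 2 : ℕ) : ℝ) + (N - 1 - N / 2 : ℕ) + 2 = N + 1 := by
    have : N / 2 + (N - 1 - N / 2) + 2 = N + 1 := by omega
    exact_mod_cast this
  have h2 : (((N - 1) / 2 : ℕ) : ℝ) + (N - 1 - (N - 1) / 2 : ℕ) + 2 = N + 1 := by
    have : (N - 1) / 2 + (N - 1 - (N - 1) / 2) + 2 = N + 1 := by omega
    exact_mod_cast this
  have h3 : ((N / 2 : ℕ) : ℝ) ≤ ((N - 1) / 2 : ℕ) + 1 := by
    have : N / 2 ≤ (N - 1) / 2 + 1 := by omega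
    exact_mod_cast this
  rw [h1, h2, ← sub_div]
  have : (0 : ℝ) < N := by exact_mod_cast hN
  rw [div_le_div_iff₀ (by positivity) this]
  nlinarith

theorem variance_upperMedian_bounds :
    |N * variance (fun x => orderStatistic x (upperMedianIndex N))
      (Measure.pi fun _ : Fin N => unitUniform) - 1 / 4| ≤ 2 / (N : ℝ) := by
  have hN := NeZero.pos N
  have hN' : (0 : ℝ) < N := by exact_mod_cast hN
  have hL := memLp_orderStatistic N (upperMedianIndex N)
  have hvar : variance (fun x => orderStatistic x (upperMedianIndex N))
      (Measure.pi fun _ : Fin N => unitUniform)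
      = variance (fun x => orderStatistic x (upperMedianIndex N) + -(1 / 2))
        (Measure.pi fun _ : Fin N => unitUniform) := by
    rw [variance_add_const hL.aestronglyMeasurable]
  have hL' : MemLp (fun x => orderStatistic x (upperMedianIndex N) + -(1 / 2)) 2
      (Measure.pi fun _ : Fin N => unitUniform) := hL.add (memLp_const _)
  rw [hvar, variance_eq_sub hL',
    integral_add (hL.integrable one_le_two) (integrable_const _),
    integral_orderStatistic (upperMedianIndex N) (N / 2) (N - 1 - N / 2) rfl (by omega)]
  have h2 := integral_orderStatistic_sub_half_sq (upperMedianIndex N) (N / 2) (N - 1 - N / 2) rfl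
    (by omega)
  simp only [Pi.pow_apply, ← sub_eq_add_neg, h2, integral_const, probReal_univ, smul_eq_mul]
  -- The two alternatives are odd and even `N`.
  have hc : (N - 1 - N / 2 = N / 2 ∨ N - 1 - N / 2 + 1 = N / 2) ∧ N = N / 2 + (N - 1 - N / 2) + 1 := by
    omega
  obtain ⟨hc, hs⟩ := hc
  set a := N / 2
  set b := N - 1 - a
  have hs' : (N : ℝ) = a + b + 1 := by exact_mod_cast hs
  rw [hs']
  rcases hc with hc | hc
  · rw [hc, abs_le]
    constructor
    · rw [← sub_nonneg]; field_simp; ring_nf; positivity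
    · rw [← sub_nonneg]; field_simp; ring_nf; positivity
  · rw [← hc]; push_cast
    rw [abs_le]
    constructor
    · rw [← sub_nonneg]; field_simp; ring_nf; positivity
    · rw [← sub_nonneg]; field_simp; ring_nf; positivity

omit [NeZero N] in
theorem integrable_orderStatistic_pow_four (k : Fin N) :
    Integrable (fun x => (orderStatistic x k - 1 / 2) ^ 4)
      (Measure.pi fun _ : Fin N => unitUniform) := by
  refine Integrable.of_bound (((measurable_orderStatistic k).sub_const _).pow_const
    4).aestronglyMeasurable 1 ?_
  filter_upwards [ae_orderStatistic_mem N k] with x hx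
  rw [Real.norm_eq_abs, abs_pow]
  refine pow_le_one₀ (abs_nonneg _) ?_
  rw [abs_le]
  constructor <;> linarith [hx.1, hx.2]

theorem integral_orderStatistic_pow_four_le (hN : 10 ≤ N) (k : Fin N)
    (hk : k = upperMedianIndex N ∨ k = lowerMedianIndex N) :
    ∫ x, (orderStatistic x k - 1 / 2) ^ 4 ∂(Measure.pi fun _ : Fin N => unitUniform)
      ≤ 7 / (N : ℝ) ^ 2 := by
  obtain ⟨h1, h2⟩ := quarticWeight_upper_lower hN k hk
  refine le_trans (integral_mono_ae (integrable_orderStatistic_pow_four k) h1 ?_) h2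
  filter_upwards [ae_orderStatistic_mem N k] with x hx using pow_four_le_quarticWeight hx

/-- If `|t| + |s| ≤ δ`, one factor `t - s` is at most `δ`; otherwise `(t - s)² ≤ (|t| + |s|)⁴ / δ²`.
The second moment of the gap between the middle order statistics is thereby bounded through its mean
and marginal fourth moments, without their joint law. -/
theorem sq_gap_le {s t δ : ℝ} (hst : s ≤ t) (hδ : 0 < δ) :
    (t - s) ^ 2 ≤ δ * (t - s) + 8 / δ ^ 2 * (t ^ 4 + s ^ 4) := by
  have hM : t - s ≤ |t| + |s| := (le_abs_self _).trans (abs_sub _ _)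
  have hM0 : 0 ≤ |t| + |s| := by positivity
  have h4 : (|t| + |s|) ^ 4 ≤ 8 * (t ^ 4 + s ^ 4) := by
    have h1 : (|t| + |s|) ^ 2 ≤ 2 * (t ^ 2 + s ^ 2) := by
      nlinarith [sq_nonneg (|t| - |s|), sq_abs t, sq_abs s]
    calc (|t| + |s|) ^ 4 = ((|t| + |s|) ^ 2) ^ 2 := by ring
      _ ≤ (2 * (t ^ 2 + s ^ 2)) ^ 2 := by gcongr
      _ ≤ _ := by nlinarith [sq_nonneg (t ^ 2 - s ^ 2)]
  rcases le_total (|t| + |s|) δ with h | h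
  · have : 0 ≤ 8 / δ ^ 2 * (t ^ 4 + s ^ 4) := by positivity
    nlinarith
  · have h5 : (t - s) ^ 2 ≤ (|t| + |s|) ^ 4 / δ ^ 2 := by
      rw [le_div_iff₀ (by positivity)]
      calc (t - s) ^ 2 * δ ^ 2 ≤ (|t| + |s|) ^ 2 * (|t| + |s|) ^ 2 := by
            gcongr
        _ = _ := by ring
    have h6 : (|t| + |s|) ^ 4 / δ ^ 2 ≤ 8 / δ ^ 2 * (t ^ 4 + s ^ 4) := by
      rw [div_mul_eq_mul_div]; gcongr
    have : 0 ≤ δ * (t - s) := mul_nonneg hδ.le (sub_nonneg.2 hst)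
    linarith

theorem variance_linearization_error_le (hN : 10 ≤ N) {δ : ℝ} (hδ : 0 < δ) :
    variance ((fun x : Fin N → ℝ => sampleMedian fun i => logExpQuantile (x i))
        - fun x => 2 / Real.log 2 * orderStatistic x (upperMedianIndex N))
      (Measure.pi fun _ : Fin N => unitUniform)
    ≤ (8 / Real.log 2) ^ 2 * (14 / (N : ℝ) ^ 2)
      + (2 / Real.log 2) ^ 2 / 2 * (δ / N + 112 / ((N : ℝ) ^ 2 * δ ^ 2)) := by
  set μ := Measure.pi fun _ : Fin N => unitUniform
  set u := upperMedianIndex N with hu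
  set l := lowerMedianIndex N with hl
  set c := 2 / Real.log 2 with hc
  have hL : MemLp ((fun x : Fin N → ℝ => sampleMedian fun i => logExpQuantile (x i))
      - fun x => c * orderStatistic x u) 2 μ :=
    (memLp_sampleMedian_logExpQuantile N).sub ((memLp_orderStatistic N u).const_mul c)
  rw [← variance_sub_const hL.aestronglyMeasurable (logExpQuantile (1 / 2) - c * (1 / 2))]
  refine (variance_le_expectation_sq (hL.sub (memLp_const _)).aestronglyMeasurable).trans ?_
  have iq := fun k hk => (quarticWeight_upper_lower hN k hk).1
  have bq := fun k hk => (quarticWeight_upper_lower hN k hk).2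
  have b4 := integral_orderStatistic_pow_four_le hN
  have i4 := integrable_orderStatistic_pow_four (N := N)
  have ig : Integrable (fun x => orderStatistic x u - orderStatistic x l) μ :=
    ((memLp_orderStatistic N u).integrable one_le_two).sub
      ((memLp_orderStatistic N l).integrable one_le_two)
  have hA : Integrable (fun x => quarticWeight (orderStatistic x u)
      + quarticWeight (orderStatistic x l)) μ := (iq u (Or.inl rfl)).add (iq l (Or.inr rfl))
  have hB : Integrable (fun x => (orderStatistic x u - 1 / 2) ^ 4
      + (orderStatistic x l - 1 / 2) ^ 4) μ := (i4 u).add (i4 l)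
  have hC : Integrable (fun x => δ * (orderStatistic x u - orderStatistic x l)
      + 8 / δ ^ 2 * ((orderStatistic x u - 1 / 2) ^ 4 + (orderStatistic x l - 1 / 2) ^ 4)) μ :=
    (ig.const_mul δ).add (hB.const_mul _)
  calc ∫ x, ((fun ω => ((fun x : Fin N → ℝ => sampleMedian fun i => logExpQuantile (x i))
        - fun x => c * orderStatistic x u) ω - (logExpQuantile (1 / 2) - c * (1 / 2))) ^ 2) x ∂μ
      ≤ ∫ x, ((8 / Real.log 2) ^ 2 * (quarticWeight (orderStatistic x u)
          + quarticWeight (orderStatistic x l))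
        + c ^ 2 / 2 * (δ * (orderStatistic x u - orderStatistic x l)
          + 8 / δ ^ 2 * ((orderStatistic x u - 1 / 2) ^ 4
            + (orderStatistic x l - 1 / 2) ^ 4))) ∂μ := by
        refine integral_mono_ae (hL.sub (memLp_const _)).integrable_sq
          ((hA.const_mul _).add (hC.const_mul _)) ?_
        filter_upwards [ae_pi_unitUniform_mem N] with x hx
        have hU := sq_quantileRemainder_le (u := orderStatistic x u) (hx _)
        have hLo := sq_quantileRemainder_le (u := orderStatistic x l) (hx _)
        have hul : orderStatistic x l ≤ orderStatistic x u := by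
          refine orderStatistic_mono x ?_
          rw [hl, hu, lowerMedianIndex, upperMedianIndex, Fin.mk_le_mk]
          omega
        have hg := sq_gap_le (s := orderStatistic x l - 1 / 2) (t := orderStatistic x u - 1 / 2)
          (by linarith) hδ
        rw [sub_sub_sub_cancel_right] at hg
        have hmed := sampleMedian_comp monotoneOn_logExpQuantile hx
        change sampleMedian (fun i => logExpQuantile (x i))
          = (logExpQuantile (orderStatistic x l) + logExpQuantile (orderStatistic x u)) / 2 at hmed
        simp only [Pi.pow_apply, Pi.sub_apply]
        rw [hmed]
        have hid : (logExpQuantile (orderStatistic x l) + logExpQuantile (orderStatistic x u)) / 2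
            - c * orderStatistic x u - (logExpQuantile (1 / 2) - c * (1 / 2))
            = (quantileRemainder (orderStatistic x u) + quantileRemainder (orderStatistic x l)) / 2
              - c * (orderStatistic x u - orderStatistic x l) / 2 := by
          rw [quantileRemainder, quantileRemainder, ← hc]; ring
        rw [hid]
        have hg' := mul_le_mul_of_nonneg_left hg (show 0 ≤ c ^ 2 / 2 by positivity)
        set r := quantileRemainder (orderStatistic x u)
        set r' := quantileRemainder (orderStatistic x l)
        set g := orderStatistic x u - orderStatistic x l
        -- Two uses of `(p ± q)² ≤ 2 p² + 2 q²` give `((r + r') / 2 - c g / 2)² ≤ r² + r'² + c² g² /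
        -- 2`.
        nlinarith [sq_nonneg ((r + r') / 2 + c * g / 2), sq_nonneg (r - r')]
    _ = (8 / Real.log 2) ^ 2 * (∫ x, quarticWeight (orderStatistic x u) ∂μ
          + ∫ x, quarticWeight (orderStatistic x l) ∂μ)
        + c ^ 2 / 2 * (δ * (∫ x, (orderStatistic x u - orderStatistic x l) ∂μ)
          + 8 / δ ^ 2 * (∫ x, (orderStatistic x u - 1 / 2) ^ 4 ∂μ
            + ∫ x, (orderStatistic x l - 1 / 2) ^ 4 ∂μ)) := by
        rw [integral_add (hA.const_mul _) (hC.const_mul _), integral_const_mul, integral_const_mul,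
          integral_add (ig.const_mul δ) (hB.const_mul _), integral_const_mul, integral_const_mul,
          integral_add (iq u (Or.inl rfl)) (iq l (Or.inr rfl)), integral_add (i4 u) (i4 l)]
    _ ≤ (8 / Real.log 2) ^ 2 * (7 / (N : ℝ) ^ 2 + 7 / (N : ℝ) ^ 2)
        + c ^ 2 / 2 * (δ * (1 / N) + 8 / δ ^ 2 * (7 / (N : ℝ) ^ 2 + 7 / (N : ℝ) ^ 2)) := by
        gcongr
        · exact bq u (Or.inl rfl)
        · exact bq l (Or.inr rfl)
        · exact integral_gap_le
        · exact b4 u (Or.inl rfl)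
        · exact b4 l (Or.inr rfl)
    _ = _ := by
        have : (N : ℝ) ≠ 0 := by exact_mod_cast NeZero.ne N
        field_simp
        ring

end MedianIndices

/-! ### Asymptotics of the variance of the median -/

section Asymptotics

/-- The variance of the sample median of `N` independent copies of the logarithm of a standard
exponential variable. -/
noncomputable def medianVariance (N : ℕ) : ℝ :=
  if h : N = 0 then 0 else
    haveI : NeZero N := ⟨h⟩
    variance (fun x : Fin N → ℝ => sampleMedian fun i => logExpQuantile (x i))
      (Measure.pi fun _ : Fin N => unitUniform)

theorem medianVariance_eq (N : ℕ) [NeZero N] :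
    medianVariance N = variance (fun x : Fin N → ℝ => sampleMedian fun i => logExpQuantile (x i))
      (Measure.pi fun _ : Fin N => unitUniform) := by
  rw [medianVariance, dif_neg (NeZero.ne N)]

theorem medianVariance_nonneg (N : ℕ) : 0 ≤ medianVariance N := by
  unfold medianVariance
  split_ifs
  · exact le_rfl
  · exact variance_nonneg _ _

theorem tendsto_mul_medianVariance :
    Tendsto (fun N : ℕ => (N : ℝ) * medianVariance N) atTop (𝓝 (1 / Real.log 2 ^ 2)) := by
  set c := 2 / Real.log 2 with hc
  have hl : 0 < Real.log 2 := Real.log_pos (by norm_num)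
  have hc0 : 0 < c := by positivity
  -- the variance of the upper middle order statistic of uniform variables
  let w : ℕ → ℝ := fun N => if h : N = 0 then 1 / 4 else
    haveI : NeZero N := ⟨h⟩
    N * variance (fun x => orderStatistic x (upperMedianIndex N))
      (Measure.pi fun _ : Fin N => unitUniform)
  have hw : Tendsto w atTop (𝓝 (1 / 4)) := by
    rw [tendsto_iff_norm_sub_tendsto_zero]
    refine squeeze_zero (fun _ => norm_nonneg _) (fun N => ?_) (tendsto_const_div_atTop_nhds_zero_nat 2)
    -- At `N = 0` the bound `2 / N` is `0` by convention, and the default value `1/4` of `w` meets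
    -- it.
    by_cases h : N = 0
    · simp [w, h]
    · have : NeZero N := ⟨h⟩
      simp only [w, dif_neg h]
      exact variance_upperMedian_bounds
  -- With `N δ⁴ = 1`, `N` times the error bound becomes a polynomial in `δ` without constant term:
  -- `N (δ / N) = δ` and `N / (N² δ²) = δ²`.
  let δ : ℕ → ℝ := fun N => (N : ℝ) ^ (-(1 / 4 : ℝ))
  have hδ : Tendsto δ atTop (𝓝 0) :=
    (tendsto_rpow_neg_atTop (by norm_num)).comp tendsto_natCast_atTop_atTop
  let ρ : ℕ → ℝ := fun N => (8 / Real.log 2) ^ 2 * 14 * δ N ^ 4 + c ^ 2 / 2 * (δ N + 112 * δ N ^ 2)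
  have hρ : Tendsto ρ atTop (𝓝 0) := by
    have h1 := ((hδ.pow 4).const_mul ((8 / Real.log 2) ^ 2 * 14)).add
      ((hδ.add ((hδ.pow 2).const_mul 112)).const_mul (c ^ 2 / 2))
    simpa using h1
  have hbound : ∀ᶠ N : ℕ in atTop, |√(N * medianVariance N) - c * √(w N)| ≤ √(ρ N) := by
    filter_upwards [eventually_ge_atTop 10] with N hN
    have hne : N ≠ 0 := by omega
    have : NeZero N := ⟨hne⟩
    have hN0 : (0 : ℝ) < N := by exact_mod_cast NeZero.pos N
    have hδN : 0 < δ N := Real.rpow_pos_of_pos hN0 _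
    have hδ4 : δ N ^ 4 = 1 / N := by
      simp only [δ]
      rw [← Real.rpow_natCast, ← Real.rpow_mul hN0.le]
      norm_num [Real.rpow_neg_one]
    have h1 := abs_sqrt_variance_sub_le (memLp_sampleMedian_logExpQuantile N)
      ((memLp_orderStatistic N (upperMedianIndex N)).const_mul c)
    rw [← medianVariance_eq, variance_const_mul, Real.sqrt_mul (sq_nonneg c),
      Real.sqrt_sq hc0.le] at h1
    have h2 := variance_linearization_error_le hN hδN
    have h3 : √(N * medianVariance N) - c * √(w N) = √N * (√(medianVariance N)
        - c * √(variance (fun x => orderStatistic x (upperMedianIndex N))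
          (Measure.pi fun _ : Fin N => unitUniform))) := by
      simp only [w, dif_neg hne]
      rw [Real.sqrt_mul hN0.le, Real.sqrt_mul hN0.le]
      ring
    rw [h3, abs_mul, abs_of_nonneg (Real.sqrt_nonneg _)]
    refine (mul_le_mul_of_nonneg_left h1 (Real.sqrt_nonneg _)).trans ?_
    rw [← Real.sqrt_mul hN0.le]
    refine Real.sqrt_le_sqrt ((mul_le_mul_of_nonneg_left h2 hN0.le).trans (le_of_eq ?_))
    simp only [ρ]
    have h5 : (N : ℝ) = 1 / δ N ^ 4 := by rw [hδ4]; field_simp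
    rw [← hc, h5]
    field_simp
  have hlim : Tendsto (fun N : ℕ => √(N * medianVariance N)) atTop (𝓝 (c * √(1 / 4))) := by
    have h1 : Tendsto (fun N : ℕ => √(N * medianVariance N) - c * √(w N)) atTop (𝓝 0) := by
      have h2 : Tendsto (fun N => √(ρ N)) atTop (𝓝 0) := by
        have h3 := (Real.continuous_sqrt.tendsto 0).comp hρ
        rwa [Real.sqrt_zero] at h3
      exact squeeze_zero_norm' hbound h2
    have h3 := h1.add ((((Real.continuous_sqrt.tendsto _).comp hw)).const_mul c)
    simpa using h3
  have h := hlim.pow 2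
  have e : (c * √(1 / 4)) ^ 2 = 1 / Real.log 2 ^ 2 := by
    rw [mul_pow, Real.sq_sqrt (by norm_num), hc]; field_simp; norm_num
  rw [e] at h
  refine h.congr fun N => ?_
  exact Real.sq_sqrt (mul_nonneg (Nat.cast_nonneg _) (medianVariance_nonneg N))

theorem medianVariance_isEquivalent :
    medianVariance ~[atTop] fun N : ℕ => 1 / ((N : ℝ) * Real.log 2 ^ 2) := by
  have hl : 0 < Real.log 2 := Real.log_pos (by norm_num)
  refine Asymptotics.isEquivalent_of_tendsto_one ?_
  have h := tendsto_mul_medianVariance.mul_const (Real.log 2 ^ 2)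
  rw [div_mul_cancel₀ _ (by positivity)] at h
  refine h.congr fun N => ?_
  rw [Pi.div_apply, div_div_eq_mul_div, div_one]
  ring

theorem abs_inv_sq_log_two_sub_lt : |1 / Real.log 2 ^ 2 - 2.08| < 0.005 := by
  have h1 := Real.log_two_gt_d9
  have h2 := Real.log_two_lt_d9
  have hl : 0 < Real.log 2 := by linarith
  rw [abs_lt]
  constructor
  · rw [lt_sub_iff_add_lt, lt_div_iff₀ (by positivity)]; nlinarith
  · rw [sub_lt_iff_lt_add, div_lt_iff₀ (by positivity)]; nlinarith

end Asymptotics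

/-! ### Mean-square integration of a process against a function -/

section IntegratedProcess

variable {X : Type*} {mX : MeasurableSpace X} {μ : Measure X}

theorem lintegral_enorm_mul_enorm_le {f g : X → ℝ} (hf : AEStronglyMeasurable f μ)
    (hg : AEStronglyMeasurable g μ) :
    ∫⁻ x, ‖f x‖ₑ * ‖g x‖ₑ ∂μ ≤ eLpNorm f 2 μ * eLpNorm g 2 μ := by
  have h := eLpNorm_smul_le_mul_eLpNorm (p := 2) (q := 2) (r := 1) hg hf
  rw [eLpNorm_one_eq_lintegral_enorm] at h
  simpa [enorm_mul] using h

/-- The hypotheses under which a process `Z` can be integrated in mean square against `φ`: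
`a` bounds the `L²` norms of `Z`, and is integrable against `φ`. -/
structure IsMeanSquareIntegrable (Z : ℝ → X → ℝ) (μ : Measure X) (φ a : ℝ → ℝ) : Prop where
  measurable : Measurable (Function.uncurry Z)
  eLpNorm_le : ∀ t, eLpNorm (Z t) 2 μ ≤ ENNReal.ofReal (a t)
  aestronglyMeasurable : AEStronglyMeasurable φ
  nonneg : ∀ t, 0 ≤ a t
  integrable : Integrable fun t => a t * φ t

namespace IsMeanSquareIntegrable

variable {Z : ℝ → X → ℝ} {φ a : ℝ → ℝ}

theorem measurable_apply (h : IsMeanSquareIntegrable Z μ φ a) (t : ℝ) : Measurable (Z t) :=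
  h.measurable.of_uncurry_left (x := t)

theorem memLp (h : IsMeanSquareIntegrable Z μ φ a) (t : ℝ) : MemLp (Z t) 2 μ :=
  ⟨(h.measurable_apply t).aestronglyMeasurable,
    (h.eLpNorm_le t).trans_lt ENNReal.ofReal_lt_top⟩

theorem lintegral_ne_top (h : IsMeanSquareIntegrable Z μ φ a) :
    ∫⁻ t, ENNReal.ofReal (a t) * ‖φ t‖ₑ ≠ ⊤ := by
  have h1 := h.integrable.hasFiniteIntegral
  rw [hasFiniteIntegral_iff_enorm] at h1
  simp_rw [enorm_mul, Real.enorm_eq_ofReal (h.nonneg _)] at h1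
  exact h1.ne

theorem aestronglyMeasurable_prod (h : IsMeanSquareIntegrable Z μ φ a) :
    AEStronglyMeasurable (fun p : X × ℝ => Z p.2 p.1 * φ p.2) (μ.prod volume) :=
  (h.measurable.comp measurable_swap).aestronglyMeasurable.mul
    h.aestronglyMeasurable.comp_snd

theorem aemeasurable_enorm (h : IsMeanSquareIntegrable Z μ φ a) :
    AEMeasurable (fun p : X × ℝ => ‖Z p.2 p.1‖ₑ * ‖φ p.2‖ₑ) (μ.prod volume) := by
  simpa only [enorm_mul] using h.aestronglyMeasurable_prod.enorm

variable [SFinite μ]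

/-- By Tonelli and Cauchy-Schwarz the left side is at most `(∫ a |φ|)²`. The measure need only be
s-finite, since the result serves both the probability measure and the spectral measure. -/
theorem lintegral_sq_lt_top (h : IsMeanSquareIntegrable Z μ φ a) :
    ∫⁻ x, (∫⁻ t, ‖Z t x‖ₑ * ‖φ t‖ₑ) * (∫⁻ t, ‖Z t x‖ₑ * ‖φ t‖ₑ) ∂μ < ⊤ := by
  set Φ : X → ENNReal := fun x => ∫⁻ t, ‖Z t x‖ₑ * ‖φ t‖ₑ with hΦ
  have hΦm : AEMeasurable Φ μ := h.aemeasurable_enorm.lintegral_prod_right'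
  have hφm : AEMeasurable (fun t => ‖φ t‖ₑ) := h.aestronglyMeasurable.enorm
  have swap : ∀ G : X → ENNReal, AEMeasurable G μ →
      ∫⁻ x, G x * Φ x ∂μ = ∫⁻ t, (∫⁻ x, G x * ‖Z t x‖ₑ ∂μ) * ‖φ t‖ₑ := by
    intro G hG
    have hae : ∀ᵐ x ∂μ, AEMeasurable (fun t => ‖Z t x‖ₑ * ‖φ t‖ₑ) :=
      Eventually.of_forall fun x =>
        ((h.measurable.of_uncurry_right (y := x)).enorm.aemeasurable).mul hφm
    calc ∫⁻ x, G x * Φ x ∂μ = ∫⁻ x, (∫⁻ t, G x * (‖Z t x‖ₑ * ‖φ t‖ₑ)) ∂μ := by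
          refine lintegral_congr_ae ?_
          filter_upwards [hae] with x hx
          rw [lintegral_const_mul'' _ hx]
      _ = ∫⁻ t, ∫⁻ x, G x * (‖Z t x‖ₑ * ‖φ t‖ₑ) ∂μ :=
          lintegral_lintegral_swap (hG.comp_fst.mul h.aemeasurable_enorm)
      _ = _ := by
          refine lintegral_congr fun t => ?_
          simp_rw [← mul_assoc]
          rw [lintegral_mul_const' _ _ enorm_ne_top]
  have bound1 : ∀ s, ∫⁻ x, ‖Z s x‖ₑ * Φ x ∂μ
      ≤ ENNReal.ofReal (a s) * ∫⁻ t, ENNReal.ofReal (a t) * ‖φ t‖ₑ := by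
    intro s
    rw [swap _ (h.measurable_apply s).enorm.aemeasurable,
      ← lintegral_const_mul' _ _ ENNReal.ofReal_ne_top]
    refine lintegral_mono fun t => ?_
    rw [← mul_assoc]
    gcongr
    exact (lintegral_enorm_mul_enorm_le (h.memLp s).1 (h.memLp t).1).trans
      (mul_le_mul' (h.eLpNorm_le s) (h.eLpNorm_le t))
  rw [swap Φ hΦm]
  calc ∫⁻ t, (∫⁻ x, Φ x * ‖Z t x‖ₑ ∂μ) * ‖φ t‖ₑ
      ≤ ∫⁻ s, (∫⁻ t, ENNReal.ofReal (a t) * ‖φ t‖ₑ) * (ENNReal.ofReal (a s) * ‖φ s‖ₑ) := by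
        refine lintegral_mono fun s => ?_
        simp_rw [mul_comm (Φ _)]
        calc _ ≤ (ENNReal.ofReal (a s) * ∫⁻ t, ENNReal.ofReal (a t) * ‖φ t‖ₑ) * ‖φ s‖ₑ := by
              gcongr; exact bound1 s
          _ = _ := by ring
    _ = (∫⁻ t, ENNReal.ofReal (a t) * ‖φ t‖ₑ) * ∫⁻ s, ENNReal.ofReal (a s) * ‖φ s‖ₑ :=
        lintegral_const_mul' _ _ h.lintegral_ne_top
    _ < ⊤ := ENNReal.mul_lt_top h.lintegral_ne_top.lt_top h.lintegral_ne_top.lt_top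

theorem memLp_integral (h : IsMeanSquareIntegrable Z μ φ a) :
    MemLp (fun x => ∫ t, Z t x * φ t) 2 μ := by
  have hm : AEStronglyMeasurable (fun x => ∫ t, Z t x * φ t) μ :=
    h.aestronglyMeasurable_prod.integral_prod_right'
  refine ⟨hm, ?_⟩
  rw [eLpNorm_lt_top_iff_lintegral_rpow_enorm_lt_top two_ne_zero ENNReal.ofNat_ne_top]
  refine lt_of_le_of_lt (lintegral_mono fun x => ?_) h.lintegral_sq_lt_top
  have h1 : ‖∫ t, Z t x * φ t‖ₑ ≤ ∫⁻ t, ‖Z t x‖ₑ * ‖φ t‖ₑ := by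
    simpa only [enorm_mul] using enorm_integral_le_lintegral_enorm (fun t => Z t x * φ t)
  simp only [ENNReal.toReal_ofNat, ENNReal.rpow_ofNat, sq]
  exact mul_le_mul' h1 h1

/-- This justifies Fubini for pairings with `g`: for fixed `t`, Cauchy-Schwarz bounds the inner
integral by `‖g‖₂ a(t) |φ(t)|`. -/
theorem integrable_mul_prod (h : IsMeanSquareIntegrable Z μ φ a) {g : X → ℝ} (hg : MemLp g 2 μ) :
    Integrable (Function.uncurry fun x t => g x * (Z t x * φ t)) (μ.prod volume) := by
  have hm : AEStronglyMeasurable (Function.uncurry fun x t => g x * (Z t x * φ t))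
      (μ.prod volume) := hg.1.comp_fst.mul h.aestronglyMeasurable_prod
  have hint : ∀ t, Integrable (fun x => g x * Z t x) μ := fun t => hg.integrable_mul (h.memLp t)
  rw [integrable_prod_iff' hm]
  constructor
  · refine Eventually.of_forall fun t => ?_
    simpa only [Function.uncurry_apply_pair, mul_assoc] using (hint t).mul_const (φ t)
  · refine (h.integrable.norm.const_mul (eLpNorm g 2 μ).toReal).mono' ?_ ?_
    · exact hm.norm.prod_swap.integral_prod_right'
    · refine Eventually.of_forall fun t => ?_
      simp only [Function.uncurry_apply_pair]
      rw [Real.norm_of_nonneg (integral_nonneg fun _ => norm_nonneg _)]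
      simp_rw [← mul_assoc, norm_mul _ (φ t)]
      rw [integral_mul_const]
      rw [← mul_assoc]
      gcongr
      rw [integral_norm_eq_lintegral_enorm (hint t).1, Real.norm_of_nonneg (h.nonneg t),
        ← ENNReal.toReal_ofReal (h.nonneg t), ← ENNReal.toReal_mul]
      refine ENNReal.toReal_mono (ENNReal.mul_ne_top hg.2.ne ENNReal.ofReal_ne_top) ?_
      simp_rw [enorm_mul]
      exact (lintegral_enorm_mul_enorm_le hg.1 (h.memLp t).1).trans
        (mul_le_mul' le_rfl (h.eLpNorm_le t))

theorem integral_mul_integral (h : IsMeanSquareIntegrable Z μ φ a) {g : X → ℝ}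
    (hg : MemLp g 2 μ) :
    ∫ x, g x * (∫ t, Z t x * φ t) ∂μ = ∫ t, (∫ x, g x * Z t x ∂μ) * φ t := by
  simp_rw [← integral_const_mul]
  rw [integral_integral_swap (h.integrable_mul_prod hg)]
  simp_rw [← mul_assoc, integral_mul_const]

theorem integrable_integral_mul (h : IsMeanSquareIntegrable Z μ φ a) {g : X → ℝ}
    (hg : MemLp g 2 μ) : Integrable fun t => (∫ x, g x * Z t x ∂μ) * φ t := by
  have := (h.integrable_mul_prod hg).integral_prod_right
  simpa only [Function.uncurry_apply_pair, ← mul_assoc, integral_mul_const] using this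

/-- The second moment of an integrated process is a double integral of its correlations. -/
theorem integral_sq (h : IsMeanSquareIntegrable Z μ φ a) :
    ∫ x, (∫ t, Z t x * φ t) ^ 2 ∂μ
      = ∫ s, (∫ t, (∫ x, Z s x * Z t x ∂μ) * φ t) * φ s := by
  simp_rw [sq]
  rw [h.integral_mul_integral h.memLp_integral]
  congr 1
  funext s
  rw [← h.integral_mul_integral (h.memLp s)]
  simp_rw [mul_comm (Z s _)]

theorem integrable_integral_correlation (h : IsMeanSquareIntegrable Z μ φ a) :
    Integrable fun s => (∫ t, (∫ x, Z s x * Z t x ∂μ) * φ t) * φ s := by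
  refine (h.integrable_integral_mul h.memLp_integral).congr (Eventually.of_forall fun s => ?_)
  simp only []
  rw [← h.integral_mul_integral (h.memLp s)]
  simp_rw [mul_comm (Z s _)]

end IsMeanSquareIntegrable

end IntegratedProcess

theorem norm_toLp_sq {Ω : Type*} {mΩ : MeasurableSpace Ω} {P : Measure Ω} {X : Ω → ℝ}
    (hX : MemLp X 2 P) : ‖hX.toLp X‖ ^ 2 = ∫ ω, X ω ^ 2 ∂P := by
  rw [← real_inner_self_eq_norm_sq, L2.inner_def]
  refine integral_congr_ae ?_
  filter_upwards [hX.coeFn_toLp] with ω hω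
  rw [hω]; simp [sq]

/-! ### Gaussianity of integrated Gaussian processes -/

section GaussianClosure

variable {Ω : Type*} {mΩ : MeasurableSpace Ω} {P : Measure Ω} [IsProbabilityMeasure P]

theorem integrable_cexp_mul_I {X : Ω → ℝ} (hX : AEStronglyMeasurable X P) (θ : ℝ) :
    Integrable (fun ω => Complex.exp (θ * X ω * Complex.I)) P := by
  refine Integrable.of_bound (C := 1) ?_ (Eventually.of_forall fun ω => ?_)
  · have : Continuous fun y : ℝ => Complex.exp (θ * y * Complex.I) := by fun_prop
    exact this.comp_aestronglyMeasurable hX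
  · rw [← Complex.ofReal_mul, Complex.norm_exp_ofReal_mul_I]

theorem norm_cexp_mul_I_sub_le (x y : ℝ) :
    ‖Complex.exp (x * Complex.I) - Complex.exp (y * Complex.I)‖ ≤ |x - y| := by
  have h : Complex.exp (x * Complex.I) - Complex.exp (y * Complex.I)
      = Complex.exp (y * Complex.I) * (Complex.exp (Complex.I * ((x - y : ℝ) : ℂ)) - 1) := by
    rw [mul_sub, ← Complex.exp_add]; push_cast; ring_nf
  rw [h, norm_mul, Complex.norm_exp_ofReal_mul_I, one_mul]
  exact Real.norm_exp_I_mul_ofReal_sub_one_le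

/-- The map is Lipschitz with constant `|θ|`, by `|e^{ix} - e^{iy}| ≤ |x - y|` and the domination of
the `L¹` norm by the `L²` norm. Hence `L²` limits of centred Gaussians are again Gaussian. -/
theorem continuous_integral_cexp (θ : ℝ) :
    Continuous fun X : Lp ℝ 2 P => ∫ ω, Complex.exp (θ * X ω * Complex.I) ∂P := by
  refine LipschitzWith.continuous (K := ‖θ‖₊) (LipschitzWith.of_dist_le_mul fun X Y => ?_)
  have hX := Lp.aestronglyMeasurable X
  have hY := Lp.aestronglyMeasurable Y
  have hXY : MemLp (fun ω => X ω - Y ω) 2 P := (Lp.memLp X).sub (Lp.memLp Y)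
  rw [dist_eq_norm, ← integral_sub (integrable_cexp_mul_I hX θ) (integrable_cexp_mul_I hY θ)]
  calc ‖∫ ω, (Complex.exp (θ * X ω * Complex.I) - Complex.exp (θ * Y ω * Complex.I)) ∂P‖
      ≤ ∫ ω, ‖θ‖ * ‖X ω - Y ω‖ ∂P := by
        refine norm_integral_le_of_norm_le ((hXY.integrable one_le_two).norm.const_mul _)
          (Eventually.of_forall fun ω => ?_)
        have := norm_cexp_mul_I_sub_le (θ * X ω) (θ * Y ω)
        rw [← mul_sub, abs_mul] at this
        simpa using this
    _ ≤ _ := by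
        rw [integral_const_mul, coe_nnnorm]
        gcongr
        rw [integral_norm_eq_lintegral_enorm hXY.1, ← eLpNorm_one_eq_lintegral_enorm, Lp.dist_def]
        refine ENNReal.toReal_mono ?_
          (eLpNorm_le_eLpNorm_of_exponent_le one_le_two hXY.1)
        exact hXY.2.ne

/-- The centred Gaussian variables in `L²`, described by their characteristic functions. -/
def centredGaussians (P : Measure Ω) : Set (Lp ℝ 2 P) :=
  {X | ∀ θ : ℝ, ∫ ω, Complex.exp (θ * X ω * Complex.I) ∂P
    = Complex.exp (-((‖X‖ ^ 2 : ℝ) * θ ^ 2 / 2))}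

theorem isClosed_centredGaussians : IsClosed (centredGaussians P) := by
  have : centredGaussians P = ⋂ θ : ℝ, {X | ∫ ω, Complex.exp (θ * X ω * Complex.I) ∂P
    = Complex.exp (-((‖X‖ ^ 2 : ℝ) * θ ^ 2 / 2))} := by
    ext X; simp [centredGaussians]
  rw [this]
  exact isClosed_iInter fun θ => isClosed_eq (continuous_integral_cexp θ) (by fun_prop)

theorem toLp_mem_centredGaussians_iff {X : Ω → ℝ} (hX : MemLp X 2 P) :
    hX.toLp X ∈ centredGaussians P ↔ P.map X = gaussianReal 0 (∫ ω, X ω ^ 2 ∂P).toNNReal := by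
  have hm := hX.1.aemeasurable
  have hprob : IsProbabilityMeasure (P.map X) := Measure.isProbabilityMeasure_map hm
  have hnn : 0 ≤ ∫ ω, X ω ^ 2 ∂P := integral_nonneg fun _ => sq_nonneg _
  have e1 : ∀ θ : ℝ, charFun (P.map X) θ
      = ∫ ω, Complex.exp (θ * (hX.toLp X) ω * Complex.I) ∂P := by
    intro θ
    rw [charFun_apply_real, integral_map hm (by fun_prop)]
    refine integral_congr_ae ?_
    filter_upwards [hX.coeFn_toLp] with ω hω
    rw [hω]
  have e2 : ∀ θ : ℝ, charFun (gaussianReal 0 (∫ ω, X ω ^ 2 ∂P).toNNReal) θ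
      = Complex.exp (-((‖hX.toLp X‖ ^ 2 : ℝ) * θ ^ 2 / 2)) := by
    intro θ
    rw [charFun_gaussianReal, norm_toLp_sq, Real.coe_toNNReal _ hnn]
    simp
  constructor
  · intro h
    refine Measure.ext_of_charFun (funext fun θ => ?_)
    rw [e1, e2]; exact h θ
  · intro h θ
    rw [← e1, ← e2, h]

/-- By duality, with no Riemann sums: a `g` orthogonal to every `B t` is orthogonal to the integral
by Fubini, and the double orthogonal complement is the closed span. -/
theorem toLp_mem_span_closure {B : ℝ → Ω → ℝ} {φ a : ℝ → ℝ}
    (h : IsMeanSquareIntegrable B P φ a) :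
    h.memLp_integral.toLp _ ∈
      (Submodule.span ℝ (Set.range fun t => (h.memLp t).toLp (B t))).topologicalClosure := by
  rw [← Submodule.orthogonal_orthogonal_eq_closure, Submodule.mem_orthogonal]
  intro g hg
  have hg2 := Lp.memLp g
  have hz : ∀ t, ∫ ω, g ω * B t ω ∂P = 0 := by
    intro t
    have h1 := (Submodule.mem_orthogonal _ g).1 hg ((h.memLp t).toLp (B t))
      (Submodule.subset_span ⟨t, rfl⟩)
    rw [L2.inner_def] at h1
    rw [← h1]
    refine integral_congr_ae ?_
    filter_upwards [(h.memLp t).coeFn_toLp] with ω hω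
    rw [hω]; simp
  rw [L2.inner_def]
  have h2 := h.integral_mul_integral hg2
  simp only [hz, zero_mul, integral_zero] at h2
  rw [← h2]
  refine integral_congr_ae ?_
  filter_upwards [h.memLp_integral.coeFn_toLp] with ω hω
  rw [hω]; simp [mul_comm]

theorem span_le_centredGaussians {B : ℝ → Ω → ℝ} (hB : IsGaussianProcess B P)
    (h0 : ∀ t, ∫ ω, B t ω ∂P = 0) (hL : ∀ t, MemLp (B t) 2 P) :
    (Submodule.span ℝ (Set.range fun t => (hL t).toLp (B t)) : Set (Lp ℝ 2 P))
      ⊆ centredGaussians P := by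
  intro Y hY
  rw [SetLike.mem_coe, Finsupp.mem_span_range_iff_exists_finsupp] at hY
  obtain ⟨c, rfl⟩ := hY
  have hS : MemLp (fun ω => ∑ t ∈ c.support, c t • B t ω) 2 P :=
    memLp_finsetSum _ fun t _ => (hL t).const_smul (c t)
  have hY : (c.sum fun t r => r • (hL t).toLp (B t)) = hS.toLp _ := by
    rw [Finsupp.sum]
    apply Lp.ext
    refine (Lp.coeFn_finsetSum _ _).trans ?_
    refine EventuallyEq.trans ?_ hS.coeFn_toLp.symm
    have : ∀ᵐ ω ∂P, ∀ t ∈ c.support,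
        (c t • (hL t).toLp (B t) : Lp ℝ 2 P) ω = c t • B t ω := by
      rw [Finset.eventually_all]
      intro t _
      filter_upwards [Lp.coeFn_smul (c t) ((hL t).toLp (B t)), (hL t).coeFn_toLp] with ω h1 h2
      rw [h1, Pi.smul_apply, h2]
    filter_upwards [this] with ω hω
    rw [Finset.sum_apply]
    exact Finset.sum_congr rfl hω
  rw [hY, toLp_mem_centredGaussians_iff]
  have hG : HasGaussianLaw (fun ω => ∑ t ∈ c.support, c t • B t ω) P :=
    (hB.smul c).hasGaussianLaw_fun_sum
  have hmean : ∫ ω, ∑ t ∈ c.support, c t • B t ω ∂P = 0 := by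
    rw [integral_finsetSum (f := fun t ω => c t • B t ω) _
      fun t _ => ((hL t).integrable one_le_two).smul (c t)]
    refine Finset.sum_eq_zero fun t _ => ?_
    rw [integral_smul, h0, smul_zero]
  rw [hG.map_eq_gaussianReal, variance_of_integral_eq_zero hS.1.aemeasurable hmean, hmean]

/-- A centred Gaussian process integrated in mean square is Gaussian. -/
theorem map_integral_eq_gaussianReal {B : ℝ → Ω → ℝ} (hB : IsGaussianProcess B P)
    (h0 : ∀ t, ∫ ω, B t ω ∂P = 0) {φ a : ℝ → ℝ} (h : IsMeanSquareIntegrable B P φ a) :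
    P.map (fun ω => ∫ t, B t ω * φ t)
      = gaussianReal 0 (∫ ω, (∫ t, B t ω * φ t) ^ 2 ∂P).toNNReal := by
  rw [← toLp_mem_centredGaussians_iff h.memLp_integral]
  exact closure_minimal (span_le_centredGaussians hB h0 h.memLp) isClosed_centredGaussians
    (toLp_mem_span_closure h)

end GaussianClosure

/-! ### Spectral representation of the covariance, and positivity of the variance -/

section Spectral

/-- The spectral measure `ξ ^ (-1 - 2 H) dξ` on the half-line of fractional Brownian motion. -/
noncomputable def spectralMeasure (H : ℝ) : Measure ℝ :=
  (volume.restrict (Set.Ioi 0)).withDensity fun ξ => ENNReal.ofReal (ξ ^ (-1 - 2 * H))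

instance sFinite_spectralMeasure (H : ℝ) : SFinite (spectralMeasure H) := by
  unfold spectralMeasure; infer_instance

theorem measurable_spectralDensity (H : ℝ) :
    Measurable fun ξ : ℝ => ENNReal.ofReal (ξ ^ (-1 - 2 * H)) := by fun_prop

theorem integrable_spectralMeasure_iff {H : ℝ} {f : ℝ → ℝ} :
    Integrable f (spectralMeasure H)
      ↔ IntegrableOn (fun ξ => ξ ^ (-1 - 2 * H) * f ξ) (Set.Ioi 0) := by
  rw [spectralMeasure, integrable_withDensity_iff_integrable_smul' (measurable_spectralDensity H)
    (Eventually.of_forall fun _ => ENNReal.ofReal_lt_top), IntegrableOn]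
  refine integrable_congr ?_
  filter_upwards [ae_restrict_mem measurableSet_Ioi] with ξ hξ
  rw [ENNReal.toReal_ofReal (Real.rpow_nonneg (le_of_lt hξ) _), smul_eq_mul]

theorem integral_spectralMeasure (H : ℝ) (f : ℝ → ℝ) :
    ∫ ξ, f ξ ∂(spectralMeasure H) = ∫ ξ in Set.Ioi 0, ξ ^ (-1 - 2 * H) * f ξ := by
  rw [spectralMeasure, integral_withDensity_eq_integral_toReal_smul (measurable_spectralDensity H)
    (Eventually.of_forall fun _ => ENNReal.ofReal_lt_top)]
  refine setIntegral_congr_fun measurableSet_Ioi fun ξ hξ => ?_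
  simp only [smul_eq_mul]
  rw [ENNReal.toReal_ofReal (Real.rpow_nonneg (le_of_lt hξ) _)]

theorem ae_restrict_of_ae_spectralMeasure {H : ℝ} {p : ℝ → Prop}
    (h : ∀ᵐ ξ ∂(spectralMeasure H), p ξ) : ∀ᵐ ξ ∂(volume.restrict (Set.Ioi (0 : ℝ))), p ξ := by
  rw [spectralMeasure, ae_withDensity_iff (measurable_spectralDensity H)] at h
  filter_upwards [h, ae_restrict_mem measurableSet_Ioi] with ξ h1 h2
  refine h1 ?_
  rw [Ne, ENNReal.ofReal_eq_zero, not_le]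
  exact Real.rpow_pos_of_pos h2 _

/-- The constant of the spectral representation of `|t| ^ (2 H)`. -/
noncomputable def spectralConst (H : ℝ) : ℝ :=
  ∫ ξ in Set.Ioi 0, ξ ^ (-1 - 2 * H) * (1 - Real.cos ξ)

variable {H : ℝ}

/-- Near `0` the integrand is at most `ξ^(1 - 2H)`, integrable as `H < 1`; beyond `1` it is at most
`2 ξ^(-1 - 2H)`, integrable as `H > 0`. -/
theorem integrableOn_spectralConst (h0 : 0 < H) (h1 : H < 1) :
    IntegrableOn (fun ξ : ℝ => ξ ^ (-1 - 2 * H) * (1 - Real.cos ξ)) (Set.Ioi 0) := by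
  have hm : ∀ s : Set ℝ, AEStronglyMeasurable
      (fun ξ : ℝ => ξ ^ (-1 - 2 * H) * (1 - Real.cos ξ)) (volume.restrict s) := fun s =>
    (Measurable.aestronglyMeasurable (by fun_prop))
  rw [← Set.Ioc_union_Ioi_eq_Ioi (zero_le_one (α := ℝ))]
  refine IntegrableOn.union ?_ ?_
  · have h2 := (intervalIntegral.intervalIntegrable_rpow' (a := 0) (b := 1) (r := 1 - 2 * H)
      (by linarith)).1
    refine Integrable.mono' h2 (hm _) ?_
    filter_upwards [ae_restrict_mem measurableSet_Ioc] with ξ hξ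
    have hc := Real.one_sub_sq_div_two_le_cos (x := ξ)
    have hp := Real.rpow_pos_of_pos hξ.1 (-1 - 2 * H)
    have hc1 := Real.cos_le_one ξ
    rw [Real.norm_of_nonneg (mul_nonneg hp.le (by linarith))]
    have h3 : ξ ^ (1 - 2 * H) = ξ ^ (-1 - 2 * H) * ξ ^ 2 := by
      rw [← Real.rpow_natCast, ← Real.rpow_add hξ.1]; congr 1; push_cast; ring
    rw [h3]
    gcongr
    nlinarith [sq_nonneg ξ]
  · have h2 := (integrableOn_Ioi_rpow_of_lt (a := -1 - 2 * H) (c := 1) (by linarith)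
      one_pos).mul_const 2
    refine Integrable.mono' h2 (hm _) ?_
    filter_upwards [ae_restrict_mem measurableSet_Ioi] with ξ hξ
    have hp := Real.rpow_pos_of_pos (zero_lt_one.trans hξ) (-1 - 2 * H)
    have hc1 := Real.cos_le_one ξ
    have hc2 := Real.neg_one_le_cos ξ
    rw [Real.norm_of_nonneg (mul_nonneg hp.le (by linarith))]
    gcongr
    linarith

theorem spectralConst_pos (h0 : 0 < H) (h1 : H < 1) : 0 < spectralConst H := by
  rw [spectralConst, setIntegral_pos_iff_support_of_nonneg_ae]
  · refine lt_of_lt_of_le ?_ (measure_mono (show Set.Ioo (0 : ℝ) 1 ⊆ _ from fun ξ hξ => ?_))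
    · simp
    · refine ⟨?_, hξ.1⟩
      have hp := Real.rpow_pos_of_pos hξ.1 (-1 - 2 * H)
      have hc : Real.cos ξ < 1 := by
        rw [← Real.cos_zero]
        exact Real.cos_lt_cos_of_nonneg_of_le_pi le_rfl (by linarith [hξ.2, Real.pi_gt_three]) hξ.1
      rw [Function.mem_support]
      exact (mul_pos hp (sub_pos.2 hc)).ne'
  · filter_upwards [ae_restrict_mem measurableSet_Ioi] with ξ hξ
    exact mul_nonneg (Real.rpow_nonneg (le_of_lt hξ) _) (sub_nonneg.2 (Real.cos_le_one ξ))
  · exact integrableOn_spectralConst h0 h1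

theorem one_sub_cos_scaling (t : ℝ) (ht : t ≠ 0) {ξ : ℝ} (hξ : 0 < ξ) :
    ξ ^ (-1 - 2 * H) * (1 - Real.cos (t * ξ))
      = |t| ^ (1 + 2 * H) * ((|t| * ξ) ^ (-1 - 2 * H) * (1 - Real.cos (|t| * ξ))) := by
  have ht' := abs_pos.2 ht
  have e1 : Real.cos (|t| * ξ) = Real.cos (t * ξ) := by
    rw [← Real.cos_abs (t * ξ), abs_mul, abs_of_pos hξ]
  have e2 : |t| ^ (1 + 2 * H) * |t| ^ (-1 - 2 * H) = 1 := by
    rw [← Real.rpow_add ht']; ring_nf; exact Real.rpow_zero _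
  rw [e1, Real.mul_rpow ht'.le hξ.le]
  linear_combination (-(ξ ^ (-1 - 2 * H) * (1 - Real.cos (t * ξ)))) * e2

theorem integrable_one_sub_cos (h0 : 0 < H) (h1 : H < 1) (t : ℝ) :
    Integrable (fun ξ => 1 - Real.cos (t * ξ)) (spectralMeasure H) := by
  rcases eq_or_ne t 0 with rfl | ht
  · simp
  · rw [integrable_spectralMeasure_iff]
    have h2 := ((integrableOn_Ioi_comp_mul_left_iff
      (fun ξ : ℝ => ξ ^ (-1 - 2 * H) * (1 - Real.cos ξ)) 0 (abs_pos.2 ht)).2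
      (by rw [mul_zero]; exact integrableOn_spectralConst h0 h1)).const_mul (|t| ^ (1 + 2 * H))
    exact IntegrableOn.congr_fun h2 (fun ξ hξ => (one_sub_cos_scaling t ht hξ).symm)
      measurableSet_Ioi

theorem integral_one_sub_cos (h0 : 0 < H) (t : ℝ) :
    ∫ ξ, (1 - Real.cos (t * ξ)) ∂(spectralMeasure H) = spectralConst H * |t| ^ (2 * H) := by
  rcases eq_or_ne t 0 with rfl | ht
  · simp [Real.zero_rpow (show 2 * H ≠ 0 by positivity)]
  · have ht' := abs_pos.2 ht
    rw [integral_spectralMeasure, setIntegral_congr_fun measurableSet_Ioi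
      (fun ξ hξ => one_sub_cos_scaling t ht hξ), integral_const_mul,
      integral_comp_mul_left_Ioi (fun ξ : ℝ => ξ ^ (-1 - 2 * H) * (1 - Real.cos ξ)) 0 ht',
      mul_zero, ← spectralConst, smul_eq_mul, Real.rpow_add ht', Real.rpow_one]
    field_simp

theorem eLpNorm_two_le_of_integral_sq_le {X : Type*} {mX : MeasurableSpace X} {μ : Measure X}
    {f : X → ℝ} (hf : AEStronglyMeasurable f μ) (hi : Integrable (fun x => f x ^ 2) μ) {r : ℝ}
    (hr : 0 ≤ r) (h : ∫ x, f x ^ 2 ∂μ ≤ r ^ 2) : eLpNorm f 2 μ ≤ ENNReal.ofReal r := by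
  have hL : MemLp f 2 μ := (memLp_two_iff_integrable_sq hf).2 hi
  rw [hL.eLpNorm_eq_integral_rpow_norm two_ne_zero ENNReal.ofNat_ne_top]
  refine ENNReal.ofReal_le_ofReal ?_
  simp only [ENNReal.toReal_ofNat, Real.rpow_ofNat, Real.norm_eq_abs, sq_abs]
  rw [← one_div, ← Real.sqrt_eq_rpow]
  exact Real.sqrt_le_iff.2 ⟨hr, h⟩

theorem integrable_one_sub_cos_sq (h0 : 0 < H) (h1 : H < 1) (t : ℝ) :
    Integrable (fun ξ => (1 - Real.cos (t * ξ)) ^ 2) (spectralMeasure H) := by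
  refine ((integrable_one_sub_cos h0 h1 t).const_mul 2).mono'
    (Measurable.aestronglyMeasurable (by fun_prop)) (Eventually.of_forall fun ξ => ?_)
  have hc1 := Real.cos_le_one (t * ξ)
  have hc2 := Real.neg_one_le_cos (t * ξ)
  rw [Real.norm_of_nonneg (sq_nonneg _)]
  nlinarith

theorem integrable_sin_sq (h0 : 0 < H) (h1 : H < 1) (t : ℝ) :
    Integrable (fun ξ => Real.sin (t * ξ) ^ 2) (spectralMeasure H) := by
  refine ((integrable_one_sub_cos h0 h1 t).const_mul 2).mono'
    (Measurable.aestronglyMeasurable (by fun_prop)) (Eventually.of_forall fun ξ => ?_)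
  have hc1 := Real.cos_le_one (t * ξ)
  have hc2 := Real.neg_one_le_cos (t * ξ)
  rw [Real.norm_of_nonneg (sq_nonneg _), Real.sin_sq]
  nlinarith

theorem integral_le_spectralBound (h0 : 0 < H) (h1 : H < 1) (t : ℝ) {f : ℝ → ℝ}
    (hf : Integrable f (spectralMeasure H)) (hle : ∀ ξ, f ξ ≤ 2 * (1 - Real.cos (t * ξ))) :
    ∫ ξ, f ξ ∂(spectralMeasure H) ≤ (√(2 * spectralConst H) * |t| ^ H) ^ 2 := by
  have hC := spectralConst_pos h0 h1
  have e : (√(2 * spectralConst H) * |t| ^ H) ^ 2 = 2 * (spectralConst H * |t| ^ (2 * H)) := by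
    rw [mul_pow, Real.sq_sqrt (by positivity), ← Real.rpow_natCast, ← Real.rpow_mul (abs_nonneg t)]
    push_cast
    rw [mul_comm H 2]; ring
  rw [e, ← integral_one_sub_cos h0, ← integral_const_mul]
  exact integral_mono hf ((integrable_one_sub_cos h0 h1 t).const_mul 2) hle

variable {φ : ℝ → ℝ}

theorem isMeanSquareIntegrable_one_sub_cos (h0 : 0 < H) (h1 : H < 1)
    (hφ : AEStronglyMeasurable φ) (hi : Integrable fun t => |t| ^ H * φ t) :
    IsMeanSquareIntegrable (fun t ξ => 1 - Real.cos (t * ξ)) (spectralMeasure H) φ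
      fun t => √(2 * spectralConst H) * |t| ^ H where
  measurable := by unfold Function.uncurry; fun_prop
  eLpNorm_le t := by
    refine eLpNorm_two_le_of_integral_sq_le (Measurable.aestronglyMeasurable (by fun_prop))
      (integrable_one_sub_cos_sq h0 h1 t) (by positivity)
      (integral_le_spectralBound h0 h1 t (integrable_one_sub_cos_sq h0 h1 t) fun ξ => ?_)
    have hc1 := Real.cos_le_one (t * ξ)
    have hc2 := Real.neg_one_le_cos (t * ξ)
    nlinarith
  aestronglyMeasurable := hφ
  nonneg t := by positivity
  integrable := by simpa only [mul_assoc] using hi.const_mul _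

theorem isMeanSquareIntegrable_sin (h0 : 0 < H) (h1 : H < 1)
    (hφ : AEStronglyMeasurable φ) (hi : Integrable fun t => |t| ^ H * φ t) :
    IsMeanSquareIntegrable (fun t ξ => Real.sin (t * ξ)) (spectralMeasure H) φ
      fun t => √(2 * spectralConst H) * |t| ^ H where
  measurable := by unfold Function.uncurry; fun_prop
  eLpNorm_le t := by
    refine eLpNorm_two_le_of_integral_sq_le (Measurable.aestronglyMeasurable (by fun_prop))
      (integrable_sin_sq h0 h1 t) (by positivity)
      (integral_le_spectralBound h0 h1 t (integrable_sin_sq h0 h1 t) fun ξ => ?_)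
    have hc1 := Real.cos_le_one (t * ξ)
    have hc2 := Real.neg_one_le_cos (t * ξ)
    rw [Real.sin_sq]
    nlinarith
  aestronglyMeasurable := hφ
  nonneg t := by positivity
  integrable := by simpa only [mul_assoc] using hi.const_mul _

/-- Pointwise, `(1 - cos a)(1 - cos b) + sin a sin b = (1 - cos a) + (1 - cos b) - (1 - cos (b -
a))`. This exhibits the fBm covariance, up to a factor, as the Gram kernel of `e^{itξ} - 1` in `L²`
of the spectral measure. -/
theorem integral_one_sub_cos_mul_add_sin_mul (h0 : 0 < H) (h1 : H < 1) (s t : ℝ) :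
    ∫ ξ, (1 - Real.cos (s * ξ)) * (1 - Real.cos (t * ξ)) ∂(spectralMeasure H)
      + ∫ ξ, Real.sin (s * ξ) * Real.sin (t * ξ) ∂(spectralMeasure H)
      = spectralConst H * (|s| ^ (2 * H) + |t| ^ (2 * H) - |t - s| ^ (2 * H)) := by
  have hL : ∀ t, MemLp (fun ξ => 1 - Real.cos (t * ξ)) 2 (spectralMeasure H) := fun t =>
    (memLp_two_iff_integrable_sq (Measurable.aestronglyMeasurable (by fun_prop))).2
      (integrable_one_sub_cos_sq h0 h1 t)
  have hS : ∀ t, MemLp (fun ξ => Real.sin (t * ξ)) 2 (spectralMeasure H) := fun t =>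
    (memLp_two_iff_integrable_sq (Measurable.aestronglyMeasurable (by fun_prop))).2
      (integrable_sin_sq h0 h1 t)
  have hi := integrable_one_sub_cos h0 h1
  have hsum : Integrable (fun ξ => (1 - Real.cos (s * ξ)) + (1 - Real.cos (t * ξ)))
      (spectralMeasure H) := (hi s).add (hi t)
  have hcc : Integrable (fun ξ => (1 - Real.cos (s * ξ)) * (1 - Real.cos (t * ξ)))
      (spectralMeasure H) := (hL s).integrable_mul (hL t)
  have hss : Integrable (fun ξ => Real.sin (s * ξ) * Real.sin (t * ξ)) (spectralMeasure H) :=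
    (hS s).integrable_mul (hS t)
  rw [← integral_add hcc hss, mul_sub,
    mul_add, ← integral_one_sub_cos h0, ← integral_one_sub_cos h0, ← integral_one_sub_cos h0,
    ← integral_add (hi s) (hi t), ← integral_sub hsum (hi (t - s))]
  congr 1
  funext ξ
  rw [sub_mul t s ξ, Real.cos_sub]
  ring

/-- The energy of the Fourier transform of `φ` for the spectral measure. -/
noncomputable def spectralEnergy (H : ℝ) (φ : ℝ → ℝ) : ℝ :=
  ∫ ξ, ‖∫ t, Complex.exp ((ξ * t : ℝ) * Complex.I) * φ t‖ ^ 2 ∂(spectralMeasure H)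

theorem integrable_cexp_mul (hφ : Integrable φ) (ξ : ℝ) :
    Integrable fun t => Complex.exp ((ξ * t : ℝ) * Complex.I) * φ t := by
  refine hφ.ofReal.bdd_mul (c := 1) ?_ (Eventually.of_forall fun t => ?_)
  · exact (Continuous.aestronglyMeasurable (by fun_prop))
  · rw [Complex.norm_exp_ofReal_mul_I]

/-- The zero mean of `φ` allows `cos` to be replaced by `cos - 1`, which, unlike `cos`, is square
integrable for the spectral measure near `0`. -/
theorem norm_sq_integral_cexp (hφ : Integrable φ) (hz : ∫ t, φ t = 0) (ξ : ℝ) :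
    ‖∫ t, Complex.exp ((ξ * t : ℝ) * Complex.I) * φ t‖ ^ 2
      = (∫ t, (1 - Real.cos (t * ξ)) * φ t) ^ 2 + (∫ t, Real.sin (t * ξ) * φ t) ^ 2 := by
  have hi := integrable_cexp_mul hφ ξ
  have hre : (∫ t, Complex.exp ((ξ * t : ℝ) * Complex.I) * φ t).re
      = ∫ t, Real.cos (t * ξ) * φ t := by
    rw [← RCLike.re_eq_complex_re, ← integral_re hi]
    congr 1; funext t
    rw [RCLike.re_eq_complex_re, Complex.re_mul_ofReal, Complex.exp_ofReal_mul_I_re, mul_comm ξ t]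
  have him : (∫ t, Complex.exp ((ξ * t : ℝ) * Complex.I) * φ t).im
      = ∫ t, Real.sin (t * ξ) * φ t := by
    rw [← RCLike.im_eq_complex_im, ← integral_im hi]
    congr 1; funext t
    rw [RCLike.im_eq_complex_im, Complex.im_mul_ofReal, Complex.exp_ofReal_mul_I_im, mul_comm ξ t]
  have hcos : ∫ t, (1 - Real.cos (t * ξ)) * φ t = -∫ t, Real.cos (t * ξ) * φ t := by
    have hc : Integrable fun t => Real.cos (t * ξ) * φ t := by
      refine hφ.bdd_mul (c := 1) (Continuous.aestronglyMeasurable (by fun_prop))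
        (Eventually.of_forall fun t => Real.abs_cos_le_one _)
    simp_rw [sub_mul, one_mul]
    rw [integral_sub hφ hc, hz, zero_sub]
  rw [Complex.sq_norm, Complex.normSq_apply, hre, him, hcos]
  ring

theorem integrable_spectralEnergy (h0 : 0 < H) (h1 : H < 1) (hφ : Integrable φ)
    (hi : Integrable fun t => |t| ^ H * φ t) (hz : ∫ t, φ t = 0) :
    Integrable (fun ξ => ‖∫ t, Complex.exp ((ξ * t : ℝ) * Complex.I) * φ t‖ ^ 2)
      (spectralMeasure H) := by
  simp_rw [norm_sq_integral_cexp hφ hz]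
  exact (isMeanSquareIntegrable_one_sub_cos h0 h1 hφ.1 hi).memLp_integral.integrable_sq.add
    (isMeanSquareIntegrable_sin h0 h1 hφ.1 hi).memLp_integral.integrable_sq

theorem spectralEnergy_eq (h0 : 0 < H) (h1 : H < 1) (hφ : Integrable φ)
    (hi : Integrable fun t => |t| ^ H * φ t) (hz : ∫ t, φ t = 0) :
    spectralEnergy H φ = spectralConst H * ∫ s, (∫ t,
      (|s| ^ (2 * H) + |t| ^ (2 * H) - |t - s| ^ (2 * H)) * φ t) * φ s := by
  have hc := isMeanSquareIntegrable_one_sub_cos h0 h1 hφ.1 hi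
  have hs := isMeanSquareIntegrable_sin h0 h1 hφ.1 hi
  rw [spectralEnergy]
  simp_rw [norm_sq_integral_cexp hφ hz]
  rw [integral_add hc.memLp_integral.integrable_sq hs.memLp_integral.integrable_sq,
    hc.integral_sq, hs.integral_sq,
    ← integral_add hc.integrable_integral_correlation hs.integrable_integral_correlation,
    ← integral_const_mul]
  congr 1
  funext s
  rw [← add_mul, ← mul_assoc, ← integral_const_mul,
    ← integral_add (hc.integrable_integral_mul (hc.memLp s))
      (hs.integrable_integral_mul (hs.memLp s))]
  congr 2
  funext t
  rw [← add_mul, ← mul_assoc, integral_one_sub_cos_mul_add_sin_mul h0 h1]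

/-- A translation multiplies the Fourier transform by a phase. This is why the coefficient variance
does not depend on the position, although fBm itself is not stationary. -/
theorem spectralEnergy_translate (k : ℝ) :
    spectralEnergy H (fun t => φ (t - k)) = spectralEnergy H φ := by
  rw [spectralEnergy, spectralEnergy]
  congr 1
  funext ξ
  have h : ∫ t, Complex.exp ((ξ * t : ℝ) * Complex.I) * (φ (t - k) : ℂ)
      = Complex.exp ((ξ * k : ℝ) * Complex.I)
        * ∫ t, Complex.exp ((ξ * t : ℝ) * Complex.I) * (φ t : ℂ) := by
    rw [← integral_sub_right_eq_self (fun t => Complex.exp ((ξ * t : ℝ) * Complex.I) * (φ t : ℂ)) k,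
      ← integral_const_mul]
    congr 1
    funext t
    rw [← mul_assoc, ← Complex.exp_add]
    congr 2
    push_cast
    ring
  rw [h, norm_mul, Complex.norm_exp_ofReal_mul_I, one_mul]

/-- An integrable function whose Fourier transform vanishes is almost everywhere zero. -/
theorem ae_eq_zero_of_integral_cexp_eq_zero (hφ : Integrable φ)
    (h : ∀ ξ : ℝ, ∫ t, Complex.exp ((ξ * t : ℝ) * Complex.I) * φ t = 0) : φ =ᵐ[volume] 0 := by
  have hp : AEMeasurable (fun t => ENNReal.ofReal (φ t)) := hφ.aemeasurable.ennreal_ofReal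
  have hn : AEMeasurable (fun t => ENNReal.ofReal (-φ t)) := hφ.neg.aemeasurable.ennreal_ofReal
  have hpf : ∫⁻ t, ENNReal.ofReal (φ t) ≠ ⊤ := hφ.lintegral_lt_top.ne
  have hnf : ∫⁻ t, ENNReal.ofReal (-φ t) ≠ ⊤ := hφ.neg.lintegral_lt_top.ne
  have f1 := isFiniteMeasure_withDensity hpf
  have f2 := isFiniteMeasure_withDensity hnf
  have key : ∀ g : ℝ → ℝ, Integrable g → ∀ ξ : ℝ,
      charFun (volume.withDensity fun t => ENNReal.ofReal (g t)) ξ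
        = ∫ t, Complex.exp ((ξ * t : ℝ) * Complex.I) * ((max (g t) 0 : ℝ) : ℂ) := by
    intro g hg ξ
    rw [charFun_apply_real, integral_withDensity_eq_integral_toReal_smul₀
      hg.aemeasurable.ennreal_ofReal (Eventually.of_forall fun _ => ENNReal.ofReal_lt_top)]
    congr 1
    funext t
    rw [ENNReal.toReal_ofReal', Complex.real_smul, mul_comm]
    push_cast
    rfl
  -- The positive and negative parts of `φ` are densities of finite measures with the same
  -- characteristic function, so they agree almost everywhere; having disjoint supports, both
  -- vanish.
  have heq : volume.withDensity (fun t => ENNReal.ofReal (φ t))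
      = volume.withDensity fun t => ENNReal.ofReal (-φ t) := by
    refine Measure.ext_of_charFun (funext fun ξ => ?_)
    rw [key φ hφ, key (fun t => -φ t) hφ.neg, ← sub_eq_zero,
      ← integral_sub (integrable_cexp_mul hφ.pos_part ξ) (integrable_cexp_mul hφ.neg_part ξ),
      ← h ξ]
    congr 1
    funext t
    rw [← mul_sub, ← Complex.ofReal_sub]
    congr 2
    rcases le_total 0 (φ t) with h' | h'
    · rw [max_eq_left h', max_eq_right (neg_nonpos.2 h'), sub_zero]
    · rw [max_eq_right h', max_eq_left (neg_nonneg.2 h'), zero_sub, neg_neg]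
  rw [withDensity_eq_iff hp hn hpf] at heq
  filter_upwards [heq] with t ht
  rcases le_total 0 (φ t) with h' | h'
  · rw [ENNReal.ofReal_of_nonpos (neg_nonpos.2 h'), ENNReal.ofReal_eq_zero] at ht
    exact le_antisymm ht h'
  · rw [ENNReal.ofReal_of_nonpos h', eq_comm, ENNReal.ofReal_eq_zero] at ht
    exact le_antisymm h' (neg_nonpos.1 ht)

/-- Zero energy forces the Fourier transform to vanish almost everywhere on the positive half-line,
hence everywhere there by continuity. Conjugation symmetry covers negative frequencies, the zero
mean covers `0`, and uniqueness of Fourier transforms gives `φ = 0`. -/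
theorem spectralEnergy_pos (h0 : 0 < H) (h1 : H < 1) (hφ : Integrable φ)
    (hi : Integrable fun t => |t| ^ H * φ t) (hz : ∫ t, φ t = 0) (hne : ¬ φ =ᵐ[volume] 0) :
    0 < spectralEnergy H φ := by
  have hnn : 0 ≤ spectralEnergy H φ := integral_nonneg fun _ => by positivity
  refine lt_of_le_of_ne hnn fun heq => hne (ae_eq_zero_of_integral_cexp_eq_zero hφ ?_)
  have h2 := (integral_eq_zero_iff_of_nonneg (fun _ => by positivity)
    (integrable_spectralEnergy h0 h1 hφ hi hz)).1 heq.symm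
  have h3 := ae_restrict_of_ae_spectralMeasure h2
  set F : ℝ → ℂ := fun ξ => ∫ t, Complex.exp ((ξ * t : ℝ) * Complex.I) * φ t with hF
  have hcont : Continuous F := by
    refine continuous_of_dominated (bound := fun t => |φ t|)
      (fun ξ => (integrable_cexp_mul hφ ξ).1) (fun ξ => Eventually.of_forall fun t => ?_) hφ.abs
      (Eventually.of_forall fun t => by fun_prop)
    rw [norm_mul, Complex.norm_exp_ofReal_mul_I, one_mul, Complex.norm_real, Real.norm_eq_abs]
  have h4 : ∀ ξ ∈ Set.Ioi (0 : ℝ), F ξ = 0 := by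
    have h5 : F =ᵐ[volume.restrict (Set.Ioi 0)] fun _ => 0 := by
      filter_upwards [h3] with ξ hξ
      exact norm_eq_zero.1 (pow_eq_zero_iff two_ne_zero |>.1 hξ)
    exact Measure.eqOn_open_of_ae_eq h5 isOpen_Ioi hcont.continuousOn continuousOn_const
  have h6 : ∀ ξ, F (-ξ) = (starRingEnd ℂ) (F ξ) := by
    intro ξ
    rw [hF]
    simp only []
    rw [← integral_conj]
    congr 1
    funext t
    rw [map_mul, Complex.conj_ofReal, ← Complex.exp_conj, map_mul, Complex.conj_ofReal,
      Complex.conj_I]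
    congr 2
    push_cast
    ring
  have h7 : F 0 = 0 := by
    rw [hF]
    simp only [zero_mul, Complex.ofReal_zero, Complex.exp_zero, one_mul]
    exact (integral_ofReal (f := φ)).trans (by rw [hz]; simp)
  intro ξ
  rcases lt_trichotomy ξ 0 with h | rfl | h
  · have := h6 (-ξ)
    rw [neg_neg, h4 (-ξ) (neg_pos.2 h), map_zero] at this
    exact this
  · exact h7
  · exact h4 ξ h

end Spectral

/-! ### Integrals of fractional Brownian paths -/

section FractionalBrownianMotion

/-- Continuity in `t` makes the process jointly measurable. No measure on `Ω` is involved, so the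
statement also applies to the `σ`-algebra generated by the process, as independence from the
position requires. -/
theorem measurable_integral_of_continuous_paths {Ω : Type*} {mΩ : MeasurableSpace Ω}
    {B : ℝ → Ω → ℝ} {φ : ℝ → ℝ} (hc : ∀ ω, Continuous fun t => B t ω) (hB : ∀ t, Measurable (B t))
    (hφ : AEStronglyMeasurable φ) : Measurable fun ω => ∫ t, B t ω * φ t := by
  have e : (fun ω => ∫ t, B t ω * φ t) = fun ω => ∫ t, B t ω * hφ.mk φ t := by
    funext ω
    refine integral_congr_ae ?_
    filter_upwards [hφ.ae_eq_mk] with t ht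
    rw [ht]
  rw [e]
  have hu : Measurable (Function.uncurry B) :=
    measurable_uncurry_of_continuous_of_measurable hc hB
  have hm : StronglyMeasurable fun p : Ω × ℝ => B p.2 p.1 * hφ.mk φ p.2 :=
    ((hu.comp measurable_swap).mul
      (hφ.stronglyMeasurable_mk.measurable.comp measurable_snd)).stronglyMeasurable
  exact hm.integral_prod_right'.measurable

theorem IsFractionalBrownianMotion.memLp_two {Ω : Type*} {mΩ : MeasurableSpace Ω}
    {P : Measure Ω} {H v : ℝ} {B : ℝ → Ω → ℝ} (hB : IsFractionalBrownianMotion H v B P) (t : ℝ) :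
    MemLp (B t) 2 P :=
  (hB.isGaussianProcess.hasGaussianLaw_eval t).memLp_two

variable {Ω : Type*} {mΩ : MeasurableSpace Ω} {P : Measure Ω} [IsProbabilityMeasure P]
  {H v : ℝ} {B : ℝ → Ω → ℝ} {φ : ℝ → ℝ}

namespace IsFractionalBrownianMotion

theorem integral_mul (hB : IsFractionalBrownianMotion H v B P) (s t : ℝ) :
    ∫ ω, B s ω * B t ω ∂P
      = v / 2 * (|s| ^ (2 * H) + |t| ^ (2 * H) - |t - s| ^ (2 * H)) := by
  have h1 := hB.covariance_eq s t
  rw [covariance_eq_sub (hB.memLp_two s) (hB.memLp_two t), hB.mean_eq_zero, zero_mul, sub_zero] at h1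
  exact h1

theorem isMeanSquareIntegrable (hB : IsFractionalBrownianMotion H v B P) (hH : 0 < H) (hv : 0 < v)
    (hφ : AEStronglyMeasurable φ) (hi : Integrable fun t => |t| ^ H * φ t) :
    IsMeanSquareIntegrable B P φ fun t => √v * |t| ^ H where
  measurable := measurable_uncurry_of_continuous_of_measurable hB.continuous_paths hB.measurable
  eLpNorm_le t := by
    refine eLpNorm_two_le_of_integral_sq_le (hB.memLp_two t).1 (hB.memLp_two t).integrable_sq
      (by positivity) (le_of_eq ?_)
    have h1 := hB.integral_mul t t
    rw [sub_self, abs_zero, Real.zero_rpow (by positivity), sub_zero] at h1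
    simp_rw [sq (B t _)]
    rw [h1, mul_pow, Real.sq_sqrt hv.le, ← Real.rpow_natCast, ← Real.rpow_mul (abs_nonneg t)]
    push_cast
    rw [mul_comm H 2]
    ring
  aestronglyMeasurable := hφ
  nonneg t := by positivity
  integrable := by simpa only [mul_assoc] using hi.const_mul _

/-- The second moment is the double integral of the covariance kernel, which `spectralEnergy_eq`
identifies with the spectral energy up to constants. -/
theorem map_integral (hB : IsFractionalBrownianMotion H v B P) (h0 : 0 < H) (h1 : H < 1)
    (hv : 0 < v) (hφ : Integrable φ) (hi : Integrable fun t => |t| ^ H * φ t)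
    (hz : ∫ t, φ t = 0) :
    P.map (fun ω => ∫ t, B t ω * φ t)
      = gaussianReal 0 (v / 2 * (spectralEnergy H φ / spectralConst H)).toNNReal := by
  have hms := hB.isMeanSquareIntegrable h0 hv hφ.1 hi
  rw [map_integral_eq_gaussianReal hB.isGaussianProcess hB.mean_eq_zero hms, hms.integral_sq]
  simp_rw [hB.integral_mul, mul_assoc (v / 2), integral_const_mul, mul_assoc (v / 2),
    integral_const_mul]
  rw [spectralEnergy_eq h0 h1 hφ hi hz, mul_div_cancel_left₀ _ (spectralConst_pos h0 h1).ne']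

omit [IsProbabilityMeasure P] in
/-- Integrals of the paths are measurable for the `σ`-algebra generated by the process. -/
theorem measurable_comap_integral (h : IsFractionalBrownianMotion H v B P)
    (hφ : AEStronglyMeasurable φ) :
    Measurable[MeasurableSpace.comap (fun ω t => B t ω) MeasurableSpace.pi]
      fun ω => ∫ t, B t ω * φ t := by
  refine @measurable_integral_of_continuous_paths Ω
    (MeasurableSpace.comap (fun ω t => B t ω) MeasurableSpace.pi) B φ h.continuous_paths
    (fun t => ?_) hφ
  exact (measurable_pi_apply t).comp (comap_measurable fun ω t => B t ω)

end IsFractionalBrownianMotion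

end FractionalBrownianMotion

/-! ### Wavelet atoms and the law of the coefficients -/

section Atoms

variable {H : ℝ} {ψ : ℝ → ℝ}

theorem ndwtAtom_translate (ψ : ℝ → ℝ) (j k : ℤ) :
    ndwtAtom ψ j k = fun t => ndwtAtom ψ j 0 (t - k) := by
  funext t; simp [ndwtAtom]

theorem integral_comp_affine (f : ℝ → ℝ) (l k : ℝ) :
    ∫ t, f (l * (t - k)) = |l⁻¹| * ∫ t, f t := by
  rw [integral_sub_right_eq_self (fun t => f (l * t)) k, Measure.integral_comp_mul_left,
    smul_eq_mul]

namespace IsAnalysingWavelet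

theorem integrable_ndwtAtom (hψ : IsAnalysingWavelet H ψ) (j k : ℤ) :
    Integrable (ndwtAtom ψ j k) :=
  ((hψ.integrable.comp_mul_left' (zpow_ne_zero j two_ne_zero)).comp_sub_right (k : ℝ)).const_mul _

/-- As `H ≤ 1`, the power `|t|^H` is subadditive. It therefore splits into a multiple of `|l (t -
k)|^H`, handled by the decay of `ψ`, and the constant `|k|^H`, handled by integrability. -/
theorem integrable_rpow_mul_ndwtAtom (hψ : IsAnalysingWavelet H ψ) (h0 : 0 < H) (h1 : H < 1)
    (j k : ℤ) : Integrable fun t => |t| ^ H * ndwtAtom ψ j k t := by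
  set l : ℝ := (2 : ℝ) ^ j with hl
  have hl0 : 0 < l := zpow_pos two_pos j
  have i1 : Integrable fun t : ℝ => |l * (t - k)| ^ H * ψ (l * (t - k)) :=
    (hψ.integrable_rpow_mul.comp_mul_left' hl0.ne').comp_sub_right (k : ℝ)
  have i2 : Integrable fun t : ℝ => (2 : ℝ) ^ ((j : ℝ) / 2) * (|l⁻¹| ^ H
      * (|l * (t - k)| ^ H * ψ (l * (t - k)))) := (i1.const_mul _).const_mul _
  refine (i2.norm.add ((hψ.integrable_ndwtAtom j k).norm.const_mul (|(k : ℝ)| ^ H))).mono' ?_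
    (Eventually.of_forall fun t => ?_)
  · exact (Measurable.aestronglyMeasurable (by fun_prop)).mul (hψ.integrable_ndwtAtom j k).1
  · have hb : |t| ^ H ≤ |l⁻¹| ^ H * |l * (t - k)| ^ H + |(k : ℝ)| ^ H := by
      rw [← Real.mul_rpow (abs_nonneg _) (abs_nonneg _), ← abs_mul, inv_mul_cancel_left₀ hl0.ne']
      refine le_trans (Real.rpow_le_rpow (abs_nonneg _) ?_ h0.le)
        (Real.rpow_add_le_add_rpow (abs_nonneg _) (abs_nonneg _) h0.le h1.le)
      simpa using abs_add_le (t - k) (k : ℝ)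
    have hn : ‖|t| ^ H * ndwtAtom ψ j k t‖ = |t| ^ H * ‖ndwtAtom ψ j k t‖ := by
      rw [norm_mul, Real.norm_of_nonneg (by positivity)]
    rw [hn]
    refine (mul_le_mul_of_nonneg_right hb (norm_nonneg _)).trans (le_of_eq ?_)
    simp only [Pi.add_apply]
    rw [add_mul]
    congr 1
    simp only [ndwtAtom, norm_mul, ← hl]
    rw [Real.norm_of_nonneg (show 0 ≤ |l⁻¹| ^ H by positivity),
      Real.norm_of_nonneg (show 0 ≤ |l * (t - k)| ^ H by positivity)]
    ring

theorem integral_ndwtAtom (hψ : IsAnalysingWavelet H ψ) (j k : ℤ) :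
    ∫ t, ndwtAtom ψ j k t = 0 := by
  simp only [ndwtAtom]
  rw [integral_const_mul, integral_comp_affine ψ, hψ.integral_eq_zero, mul_zero, mul_zero]

theorem ndwtAtom_ne_zero (hψ : IsAnalysingWavelet H ψ) (j k : ℤ) :
    ¬ ndwtAtom ψ j k =ᵐ[volume] 0 := by
  intro h
  apply hψ.ne_zero
  have hl0 : (0 : ℝ) < 2 ^ j := zpow_pos two_pos j
  have hc : (0 : ℝ) < 2 ^ ((j : ℝ) / 2) := Real.rpow_pos_of_pos two_pos _
  have h1 : ∫ t : ℝ, ‖ψ (2 ^ j * (t - k))‖ = 0 := by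
    refine integral_eq_zero_of_ae ?_
    filter_upwards [h] with t ht
    rw [ndwtAtom, Pi.zero_apply, mul_eq_zero] at ht
    simpa using ht.resolve_left hc.ne'
  rw [integral_comp_affine (fun x => ‖ψ x‖), mul_eq_zero] at h1
  have h2 := h1.resolve_left (by positivity)
  rw [integral_eq_zero_iff_of_nonneg (fun _ => norm_nonneg _) hψ.integrable.norm] at h2
  filter_upwards [h2] with t ht
  simpa using ht

end IsAnalysingWavelet

/-- The variance of the level-`j` wavelet coefficients of fractional Brownian motion. -/
noncomputable def coeffVariance (H v : ℝ) (ψ : ℝ → ℝ) (j : ℤ) : NNReal :=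
  (v / 2 * (spectralEnergy H (ndwtAtom ψ j 0) / spectralConst H)).toNNReal

theorem coeffVariance_pos {v : ℝ} (h0 : 0 < H) (h1 : H < 1) (hv : 0 < v)
    (hψ : IsAnalysingWavelet H ψ) (j : ℤ) : 0 < coeffVariance H v ψ j := by
  rw [coeffVariance, Real.toNNReal_pos]
  have := spectralConst_pos h0 h1
  have := spectralEnergy_pos h0 h1 (hψ.integrable_ndwtAtom j 0)
    (hψ.integrable_rpow_mul_ndwtAtom h0 h1 j 0) (hψ.integral_ndwtAtom j 0) (hψ.ndwtAtom_ne_zero j 0)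
  positivity

variable {Ω : Type*} {mΩ : MeasurableSpace Ω} {P : Measure Ω} [IsProbabilityMeasure P]
  {v : ℝ} {B : ℝ → Ω → ℝ}

theorem map_ndwtCoeff (h : IsFractionalBrownianMotion H v B P) (h0 : 0 < H) (h1 : H < 1)
    (hv : 0 < v) (hψ : IsAnalysingWavelet H ψ) (j k : ℤ) :
    P.map (fun ω => ndwtCoeff ψ (fun t => B t ω) j k) = gaussianReal 0 (coeffVariance H v ψ j) := by
  simp only [ndwtCoeff]
  rw [h.map_integral h0 h1 hv (hψ.integrable_ndwtAtom j k)
    (hψ.integrable_rpow_mul_ndwtAtom h0 h1 j k) (hψ.integral_ndwtAtom j k), coeffVariance,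
    ndwtAtom_translate ψ j k, spectralEnergy_translate]

omit [IsProbabilityMeasure P] in
theorem measurable_comap_ndwtCoeff (h : IsFractionalBrownianMotion H v B P)
    (hψ : IsAnalysingWavelet H ψ) (j k : ℤ) :
    Measurable[MeasurableSpace.comap (fun ω t => B t ω) MeasurableSpace.pi]
      fun ω => ndwtCoeff ψ (fun t => B t ω) j k :=
  h.measurable_comap_integral (hψ.integrable_ndwtAtom j k).1

omit [IsProbabilityMeasure P] in
theorem measurable_ndwtCoeff (h : IsFractionalBrownianMotion H v B P)
    (hψ : IsAnalysingWavelet H ψ) (j k : ℤ) :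
    Measurable fun ω => ndwtCoeff ψ (fun t => B t ω) j k :=
  (measurable_comap_ndwtCoeff h hψ j k).mono
    (measurable_pi_lambda _ h.measurable).comap_le le_rfl

theorem preimage_ndwtCoeff_random (K : Ω → ℤ) (j : ℤ) (A : Set ℝ) :
    (fun ω => ndwtCoeff ψ (fun t => B t ω) j (K ω)) ⁻¹' A
      = ⋃ k : ℤ, ((fun ω => ndwtCoeff ψ (fun t => B t ω) j k) ⁻¹' A) ∩ K ⁻¹' {k} := by
  ext ω; simp

omit [IsProbabilityMeasure P] in
theorem measurable_ndwtCoeff_random (h : IsFractionalBrownianMotion H v B P)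
    (hψ : IsAnalysingWavelet H ψ) (j : ℤ) {K : Ω → ℤ} (hK : Measurable K) :
    Measurable fun ω => ndwtCoeff ψ (fun t => B t ω) j (K ω) := by
  intro A hA
  rw [preimage_ndwtCoeff_random]
  exact MeasurableSet.iUnion fun k =>
    (measurable_ndwtCoeff h hψ j k hA).inter (hK (measurableSet_singleton k))

/-- Sampling the position independently of the process does not change the law. -/
theorem map_ndwtCoeff_random (h : IsFractionalBrownianMotion H v B P) (h0 : 0 < H) (h1 : H < 1)
    (hv : 0 < v) (hψ : IsAnalysingWavelet H ψ) (j : ℤ) {K : Ω → ℤ} (hK : Measurable K)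
    (hind : IndepFun (fun ω t => B t ω) K P) :
    P.map (fun ω => ndwtCoeff ψ (fun t => B t ω) j (K ω))
      = gaussianReal 0 (coeffVariance H v ψ j) := by
  ext A hA
  rw [Measure.map_apply (measurable_ndwtCoeff_random h hψ j hK) hA, preimage_ndwtCoeff_random,
    measure_iUnion]
  -- On `K = k` the coefficient is the one at the fixed position `k`, an event of the `σ`-algebra of
  -- the process, so the probability factors. The first factor does not depend on `k`, and the
  -- others sum to one.
  · have hk : ∀ k : ℤ, P (((fun ω => ndwtCoeff ψ (fun t => B t ω) j k) ⁻¹' A) ∩ K ⁻¹' {k})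
        = gaussianReal 0 (coeffVariance H v ψ j) A * P.map K {k} := by
      intro k
      rw [IndepFun_iff_Indep, Indep_iff] at hind
      rw [hind _ _ (measurable_comap_ndwtCoeff h hψ j k hA) ⟨{k}, measurableSet_singleton k, rfl⟩,
        ← Measure.map_apply (measurable_ndwtCoeff h hψ j k) hA, map_ndwtCoeff h h0 h1 hv hψ,
        Measure.map_apply hK (measurableSet_singleton k)]
    have hprob : IsProbabilityMeasure (P.map K) := Measure.isProbabilityMeasure_map hK.aemeasurable
    have hsum : ∑' k : ℤ, P.map K {k} = 1 := by
      rw [← measure_univ (μ := P.map K), ← Set.iUnion_of_singleton ℤ, measure_iUnion]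
      · intro a b hab; simpa using hab
      · exact fun k => measurableSet_singleton k
    simp_rw [hk]
    rw [ENNReal.tsum_mul_left, hsum, mul_one]
  · intro a b hab
    refine Set.disjoint_left.2 fun ω h1 h2 => hab ?_
    exact h1.2.symm.trans h2.2
  · exact fun k => (measurable_ndwtCoeff h hψ j k hA).inter (hK (measurableSet_singleton k))

end Atoms

/-! ### From Gaussian pairs to uniform variables -/

section GaussianPairs

/-- The transform of a pair of centred Gaussian variables of variance `w` to a uniform one. -/
noncomputable def gaussianPairToUniform (w : NNReal) (p : ℝ × ℝ) : ℝ :=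
  1 - Real.exp (-((p.1 ^ 2 + p.2 ^ 2) / (2 * w)))

theorem measurable_gaussianPairToUniform (w : NNReal) : Measurable (gaussianPairToUniform w) := by
  unfold gaussianPairToUniform; fun_prop

theorem image_one_sub_exp {w : ℝ} (hw : 0 < w) :
    (fun r : ℝ => 1 - Real.exp (-(r ^ 2 / (2 * w)))) '' Set.Ioi 0 = Set.Ioo 0 1 := by
  ext u
  constructor
  · rintro ⟨r, hr, rfl⟩
    have hr' : (0 : ℝ) < r := hr
    have h1 : Real.exp (-(r ^ 2 / (2 * w))) < 1 := by
      rw [Real.exp_lt_one_iff]; exact neg_neg_of_pos (by positivity)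
    exact ⟨by linarith, by linarith [Real.exp_pos (-(r ^ 2 / (2 * w)))]⟩
  · rintro ⟨h0, h1⟩
    have hL : 0 < -Real.log (1 - u) := h0.trans_le (le_neg_log_one_sub h1)
    refine ⟨√(2 * w * -Real.log (1 - u)), Real.sqrt_pos.2 (by positivity), ?_⟩
    simp only []
    rw [Real.sq_sqrt (by positivity), mul_div_cancel_left₀ _ (by positivity), neg_neg,
      Real.exp_log (by linarith)]
    ring

theorem lintegral_Ioi_exp_sq {w : ℝ} (hw : 0 < w) (f : ℝ → ENNReal) :
    ∫⁻ r in Set.Ioi 0, ENNReal.ofReal (r / w * Real.exp (-(r ^ 2 / (2 * w))))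
        * f (1 - Real.exp (-(r ^ 2 / (2 * w)))) = ∫⁻ u in Set.Ioo 0 1, f u := by
  have hd : ∀ r : ℝ, HasDerivAt (fun r : ℝ => 1 - Real.exp (-(r ^ 2 / (2 * w))))
      (r / w * Real.exp (-(r ^ 2 / (2 * w)))) r := by
    intro r
    have h1 := ((((hasDerivAt_pow 2 r).div_const (2 * w)).neg).exp).const_sub 1
    refine h1.congr_deriv ?_
    field_simp
    norm_num
    ring
  rw [← image_one_sub_exp hw, lintegral_image_eq_lintegral_deriv_mul_of_monotoneOn measurableSet_Ioi
    (fun r _ => (hd r).hasDerivWithinAt)]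
  intro a ha b hb hab
  have ha' : (0 : ℝ) < a := ha
  simp only []
  gcongr

/-- In polar coordinates the joint density is radial: the angle contributes `2 π`, which the
normalisation cancels, and the radius has density `r / w * exp (-r² / (2 w))`, the derivative of the
substitution `u = 1 - exp (-r² / (2 w))`. -/
theorem map_gaussianPairToUniform {w : NNReal} (hw : 0 < w) :
    ((gaussianReal 0 w).prod (gaussianReal 0 w)).map (gaussianPairToUniform w) = unitUniform := by
  have hw' : (0 : ℝ) < w := hw
  have hm := measurable_gaussianPairToUniform w
  refine Measure.ext_of_lintegral _ fun f hf => ?_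
  have hfm : Measurable fun a => f (gaussianPairToUniform w a) := hf.comp hm
  rw [lintegral_map hf hm, gaussianReal_of_var_ne_zero 0 hw.ne',
    prod_withDensity (measurable_gaussianPDF 0 w) (measurable_gaussianPDF 0 w),
    lintegral_withDensity_eq_lintegral_mul _ (by fun_prop) hfm, ← Measure.volume_eq_prod,
    ← lintegral_comp_polarCoord_symm, unitUniform, ← lintegral_Ioi_exp_sq hw' f]
  let G : ℝ → ENNReal := fun r => ENNReal.ofReal (r / w * Real.exp (-(r ^ 2 / (2 * w))))
    * f (1 - Real.exp (-(r ^ 2 / (2 * w))))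
  have hG : Measurable G := by fun_prop
  have e : ∀ p ∈ polarCoord.target, ENNReal.ofReal p.1 •
      ((fun z : ℝ × ℝ => gaussianPDF 0 w z.1 * gaussianPDF 0 w z.2)
        * fun a => f (gaussianPairToUniform w a)) (polarCoord.symm p)
      = ENNReal.ofReal (2 * Real.pi)⁻¹ * G p.1 := by
    rintro ⟨r, θ⟩ ⟨hr, -⟩
    have hr' : (0 : ℝ) < r := hr
    have hsq : (r * Real.cos θ) ^ 2 + (r * Real.sin θ) ^ 2 = r ^ 2 := by
      rw [mul_pow, mul_pow, ← mul_add, Real.cos_sq_add_sin_sq, mul_one]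
    simp only [polarCoord_symm_apply, Pi.mul_apply, gaussianPairToUniform, hsq, smul_eq_mul,
      gaussianPDF, gaussianPDFReal, sub_zero]
    have hexp : Real.exp (-(r * Real.cos θ) ^ 2 / (2 * w))
        * Real.exp (-(r * Real.sin θ) ^ 2 / (2 * w)) = Real.exp (-(r ^ 2 / (2 * w))) := by
      rw [← Real.exp_add, ← add_div, ← neg_add, hsq, neg_div]
    have hden : r * ((√(2 * Real.pi * w))⁻¹ * Real.exp (-(r * Real.cos θ) ^ 2 / (2 * w))
        * ((√(2 * Real.pi * w))⁻¹ * Real.exp (-(r * Real.sin θ) ^ 2 / (2 * w))))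
        = (2 * Real.pi)⁻¹ * (r / w * Real.exp (-(r ^ 2 / (2 * w)))) := by
      rw [mul_mul_mul_comm, hexp, ← mul_inv, Real.mul_self_sqrt (by positivity)]
      field_simp
    simp only [G]
    rw [← ENNReal.ofReal_mul (by positivity), ← mul_assoc, ← ENNReal.ofReal_mul hr'.le, hden,
      ENNReal.ofReal_mul (by positivity), mul_assoc]
  rw [setLIntegral_congr_fun polarCoord.open_target.measurableSet e,
    lintegral_const_mul (f := fun p : ℝ × ℝ => G p.1) _ (hG.comp measurable_fst),
    polarCoord_target, Measure.volume_eq_prod,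
    ← Measure.prod_restrict]
  have hprod := lintegral_prod_mul (μ := volume.restrict (Set.Ioi (0 : ℝ)))
    (ν := volume.restrict (Set.Ioo (-Real.pi) Real.pi)) hG.aemeasurable
    (aemeasurable_const (b := (1 : ENNReal)))
  simp only [mul_one] at hprod
  have hc : ENNReal.ofReal (2 * Real.pi)⁻¹ * ENNReal.ofReal (Real.pi - -Real.pi) = 1 := by
    rw [← ENNReal.ofReal_mul (by positivity), sub_neg_eq_add, ← two_mul,
      inv_mul_cancel₀ (by positivity), ENNReal.ofReal_one]
  rw [hprod, setLIntegral_one, Real.volume_Ioo, mul_comm (∫⁻ _, _ ∂_), ← mul_assoc, hc, one_mul]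

end GaussianPairs

/-! ### Independent pairs and the reduction to a uniform sample -/

section Pairing

/-- The law is checked for the inverse map, which unpacks pairs: there the preimage of a box is a
product of rectangles, and boxes determine a product measure. -/
theorem map_pi_pairs {N : ℕ} (γ : Measure ℝ) [IsProbabilityMeasure γ] :
    (Measure.pi fun _ : Fin N × Fin 2 => γ).map (fun x (i : Fin N) => (x (i, 0), x (i, 1)))
      = Measure.pi fun _ : Fin N => γ.prod γ := by
  have hm1 : Measurable fun (x : Fin N × Fin 2 → ℝ) (i : Fin N) => (x (i, 0), x (i, 1)) := by
    fun_prop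
  have hm2 : Measurable fun (y : Fin N → ℝ × ℝ) (p : Fin N × Fin 2) =>
      if p.2 = 0 then (y p.1).1 else (y p.1).2 := by
    refine measurable_pi_lambda _ fun p => ?_
    split_ifs <;> fun_prop
  have h : (Measure.pi fun _ : Fin N => γ.prod γ).map
      (fun y (p : Fin N × Fin 2) => if p.2 = 0 then (y p.1).1 else (y p.1).2)
      = Measure.pi fun _ : Fin N × Fin 2 => γ := by
    symm
    refine Measure.pi_eq fun s hs => ?_
    rw [Measure.map_apply hm2 (MeasurableSet.univ_pi hs)]
    have hpre : (fun (y : Fin N → ℝ × ℝ) (p : Fin N × Fin 2) =>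
        if p.2 = 0 then (y p.1).1 else (y p.1).2) ⁻¹' Set.univ.pi s
        = Set.univ.pi fun i => s (i, 0) ×ˢ s (i, 1) := by
      ext y
      simp [Set.mem_pi, Prod.forall, Fin.forall_fin_two]
    rw [hpre, Measure.pi_pi, Fintype.prod_prod_type]
    simp [Measure.prod_prod, Fin.prod_univ_two]
  rw [← h, Measure.map_map hm1 hm2]
  have hid : (fun (x : Fin N × Fin 2 → ℝ) (i : Fin N) => (x (i, 0), x (i, 1)))
      ∘ (fun (y : Fin N → ℝ × ℝ) (p : Fin N × Fin 2) =>
        if p.2 = 0 then (y p.1).1 else (y p.1).2) = id := by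
    funext y i; simp
  rw [hid, Measure.map_id]

theorem measurePreserving_uniform_of_gaussian {Ω : Type*} {mΩ : MeasurableSpace Ω} {P : Measure Ω}
    [IsProbabilityMeasure P] {N : ℕ} {w : NNReal} (hw : 0 < w) {d : Fin N × Fin 2 → Ω → ℝ}
    (hd : ∀ p, Measurable (d p)) (hlaw : ∀ p, P.map (d p) = gaussianReal 0 w)
    (hind : iIndepFun d P) :
    MeasurePreserving (fun ω (i : Fin N) => gaussianPairToUniform w (d (i, 0) ω, d (i, 1) ω)) P
      (Measure.pi fun _ : Fin N => unitUniform) := by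
  have hU := measurable_gaussianPairToUniform w
  have m1 : MeasurePreserving (fun ω p => d p ω) P
      (Measure.pi fun _ : Fin N × Fin 2 => gaussianReal 0 w) := by
    refine ⟨measurable_pi_lambda _ hd, ?_⟩
    rw [(iIndepFun_iff_map_fun_eq_pi_map fun p => (hd p).aemeasurable).1 hind]
    simp_rw [hlaw]
  have m2 : MeasurePreserving (fun (x : Fin N × Fin 2 → ℝ) (i : Fin N) => (x (i, 0), x (i, 1)))
      (Measure.pi fun _ : Fin N × Fin 2 => gaussianReal 0 w)
      (Measure.pi fun _ : Fin N => (gaussianReal 0 w).prod (gaussianReal 0 w)) :=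
    ⟨by fun_prop, map_pi_pairs _⟩
  have m3 := measurePreserving_pi
    (fun _ : Fin N => (gaussianReal 0 w).prod (gaussianReal 0 w)) (fun _ => unitUniform)
    (fun _ => ⟨hU, map_gaussianPairToUniform hw⟩)
  exact (m3.comp m2).comp m1

/-- If `u` is the transformed value, then `-log (1 - u) = (x² + y²) / (2 w)`. The hypothesis
excludes `x = y = 0`, where the convention `log 0 = 0` would break the additive splitting. -/
theorem logAveragedEnergy_eq {w : NNReal} (hw : 0 < w) {x y : ℝ}
    (h : gaussianPairToUniform w (x, y) ∈ Set.Ioo (0 : ℝ) 1) :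
    logAveragedEnergy x y = Real.log w + logExpQuantile (gaussianPairToUniform w (x, y)) := by
  have hw' : (0 : ℝ) < w := hw
  have hq : 0 < x ^ 2 + y ^ 2 := by
    refine lt_of_le_of_ne (by positivity) fun h0 => ?_
    have := h.1
    rw [gaussianPairToUniform, ← h0] at this
    simp at this
  rw [logAveragedEnergy, logExpQuantile, gaussianPairToUniform, sub_sub_cancel, Real.log_exp,
    neg_neg, ← Real.log_mul hw'.ne' (by positivity)]
  congr 1
  field_simp

end Pairing

/-! ### The variance of the MEDLA median -/

theorem mainTheorem6 :
    ∃ V : ℕ → ℝ,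
      V ~[atTop] (fun N : ℕ => 1 / ((N : ℝ) * Real.log 2 ^ 2)) ∧
      |1 / Real.log 2 ^ 2 - 2.08| < 0.005 ∧
      ∀ (Ω : Type*) [MeasurableSpace Ω] (P : Measure Ω) [IsProbabilityMeasure P]
        (H v : ℝ) (_ : 0 < H) (_ : H < 1) (_ : 0 < v)
        (ψ : ℝ → ℝ) (_ : IsAnalysingWavelet H ψ)
        (j : ℤ) (N : ℕ) [NeZero N]
        (B : Fin N × Fin 2 → ℝ → Ω → ℝ) (K : Fin N × Fin 2 → Ω → ℤ)
        (_ : ∀ p, IsFractionalBrownianMotion H v (B p) P)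
        (_ : ∀ p, Measurable (K p))
        (_ : ∀ p, IndepFun (fun ω t => B p t ω) (K p) P)
        (_ : iIndepFun (fun p ω => ndwtCoeff ψ (fun t => B p t ω) j (K p ω)) P),
        MemLp (medlaMedian ψ j B K) 2 P ∧
          variance (medlaMedian ψ j B K) P = V N := by
  refine ⟨medianVariance, medianVariance_isEquivalent, abs_inv_sq_log_two_sub_lt, ?_⟩
  intro Ω _ P _ H v h0 h1 hv ψ hψ j N _ B K hB hK hBK hind
  set w := coeffVariance H v ψ j
  have hw : 0 < w := coeffVariance_pos h0 h1 hv hψ j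
  set d : Fin N × Fin 2 → Ω → ℝ := fun p ω => ndwtCoeff ψ (fun t => B p t ω) j (K p ω) with hd
  have hU := measurePreserving_uniform_of_gaussian hw
    (fun p => measurable_ndwtCoeff_random (hB p) hψ j (hK p))
    (fun p => map_ndwtCoeff_random (hB p) h0 h1 hv hψ j (hK p) (hBK p)) hind
  set U : Ω → Fin N → ℝ := fun ω i => gaussianPairToUniform w (d (i, 0) ω, d (i, 1) ω)
  set M : (Fin N → ℝ) → ℝ := fun x => sampleMedian fun i => logExpQuantile (x i)
  have hM : MemLp M 2 (Measure.pi fun _ : Fin N => unitUniform) :=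
    memLp_sampleMedian_logExpQuantile N
  have hMU : MemLp (M ∘ U) 2 P := hM.comp_measurePreserving hU
  -- The identity holds only almost surely, off the null event that some pair of coefficients
  -- vanishes. The parameters now survive only in the additive constant `log w`.
  have hae : medlaMedian ψ j B K =ᵐ[P] fun ω => Real.log w + (M ∘ U) ω := by
    filter_upwards [hU.quasiMeasurePreserving.ae (ae_pi_unitUniform_mem N)] with ω hω
    rw [medlaMedian, Function.comp_apply, ← sampleMedian_const_add]
    congr 1
    funext i
    exact logAveragedEnergy_eq hw (hω i)
  constructor
  · exact ((memLp_const (Real.log w)).add hMU).ae_eq hae.symm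
  · rw [variance_congr hae, variance_const_add hMU.1, medianVariance_eq, ← hU.map_eq,
      variance_map (by rw [hU.map_eq]; exact hM.1.aemeasurable) hU.measurable.aemeasurable]
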